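/- Let $E_4, E_6$ be the normalized Eisenstein series (constant term $1$), $\Delta=(E_4^3-E_6^2)/1728$ and $j=E_4^3/\Delta$ on the upper half-plane $\mathbb H$. Let $\mathcal F$ be the strict fundamental domain of $\mathrm{SL}_2(\mathbb Z)$: the set of $\tau\in\mathbb H$ with $|\tau|\ge 1$, $-\tfrac12\le \Re\tau<\tfrac12$, and $\Re\tau\le 0$ if $|\tau|=1$. Let $\alpha\in\mathbb C$, and let $z=x+iy\in\mathcal F$ with $j(z)=\alpha$. Let $a(n)$ $(n\ge 0)$ be the coefficients of the $q$-expansion at $i\infty$ of $$H_z(\tau)=-\frac1{2\pi i}\,\frac{j'(\tau)}{j(\tau)-\alpha},$$ and let $b(n)=\dfrac{\log|a(n)|}{2\pi n}$. Then the following hold. 1. $H_z(\tau)=\sum_{n\ge 0}a(n)e^{2\pi i n\tau}$ for all $\tau$ with $\Im\tau>y$. 2. $y=\limsup_{n\to\infty} b(n)$. Moreover $y=\lim_{n\to\infty} b(n)$ if and only if either $|z|>1$, or for every $\varepsilon>0$ one has $|\cos(2\pi n x)|\ge e^{-\varepsilon n}$ for all sufficiently large $n$. (The second condition holds in particular when $\alpha=0$;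 it fails, for example, for $z=\frac{-1+i\sqrt{15}}4$.) 3. If $\alpha=0$, then $x=-\tfrac12$. 4. Suppose $\alpha\ne0$. For $y_0\in\mathbb R$ put $$c(n)=\begin{cases}\Re(a(n))\,e^{-2\pi n y_0}&\text{if }\lim_{m\to\infty}|a(m)|e^{-2\pi m y}=1,\\[2pt] \tfrac12 a(n)\,e^{-2\pi n y_0}&\text{otherwise,}\end{cases}$$ where in the second case all $a(n)$ are real, and put $w_n=\arccos c(n)\in[0,\pi]$, with $\arccos t=0$ for $t>1$ and $\arccos t=\pi$ for $t<-1$. Then for every $\varepsilon>0$ there are $\eta>0$ and $N\ge1$ such that, for every $n\ge N$ and every $y_0$ with $|y_0-y|\le \eta/n$, the number $x$ lies within distance less than $\varepsilon$ of at least one of the six numbers $$\pm\frac1{2\pi}(w_n+w_{n-1}),\qquad \pm\frac1{2\pi}(w_n-w_{n-1}),\qquad \pm\frac1{2\pi}(w_n+w_{n-1}-2\pi).$$ -/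

import Mathlib

open scoped UpperHalfPlane

noncomputable section

namespace JInversion

/-- The normalized Eisenstein series of weight 4 (constant term 1). -/
def E4 (τ : ℍ) : ℂ := ModularForm.E (k := 4) (by norm_num) τ

/-- The normalized Eisenstein series of weight 6 (constant term 1). -/
def E6 (τ : ℍ) : ℂ := ModularForm.E (k := 6) (by norm_num) τ

/-- The modular discriminant `(E₄³ - E₆²) / 1728`. -/
def Delta (τ : ℍ) : ℂ := (E4 τ ^ 3 - E6 τ ^ 2) / 1728

/-- The modular function `j = E₄³ / Δ`. -/
def j (τ : ℍ) : ℂ := E4 τ ^ 3 / Delta τ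

/-- The strict fundamental domain of `SL₂(ℤ)` acting on the upper half-plane, which contains exactly
one point of every orbit: `|τ| ≥ 1` and `-1/2 ≤ Re τ < 1/2`, with only the left half of the unit
arc. -/
def fundamentalDomain : Set ℍ :=
  {τ | 1 ≤ ‖(τ : ℂ)‖ ∧ -(1 / 2) ≤ τ.re ∧ τ.re < 1 / 2 ∧ (‖(τ : ℂ)‖ = 1 → τ.re ≤ 0)}

/-- The meromorphic form `-(1 / 2πi) j'(τ) / (j(τ) - α)`. -/
def H (α : ℂ) (τ : ℍ) : ℂ :=
  -(1 / (2 * (Real.pi : ℂ) * Complex.I)) * (deriv (j ∘ UpperHalfPlane.ofComplex) (τ : ℂ) / (j τ - α))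

/-- The `n`-th coefficient of the expansion of `H α` in `q = exp(2πiτ)` at the cusp `i∞`. -/
def a (α : ℂ) (n : ℕ) : ℂ := (UpperHalfPlane.qExpansion 1 (H α)).coeff n

/-- `b(n) = log |a(n)| / (2πn)`. -/
def b (α : ℂ) (n : ℕ) : ℝ := Real.log ‖a α n‖ / (2 * Real.pi * n)

/-- The condition `lim |a(n)| exp(-2πny) = 1`. -/
def UnitLimit (α : ℂ) (y : ℝ) : Prop :=
  Filter.Tendsto (fun n : ℕ => ‖a α n‖ * Real.exp (-(2 * Real.pi * n * y))) Filter.atTop (nhds 1)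

open Classical in
/-- The rescaled coefficients, with approximation `y₀` of `y`: `Re(a(n)) exp(-2πny₀)` if
`lim |a(n)| exp(-2πny) = 1`, and `a(n) exp(-2πny₀) / 2` otherwise (`a(n)` is then real when
`α ≠ 0`, so that its real part is `a(n)` itself; the theorem asserts this). -/
def c (α : ℂ) (y y₀ : ℝ) (n : ℕ) : ℝ :=
  if UnitLimit α y then (a α n).re * Real.exp (-(2 * Real.pi * n * y₀))
  else 1 / 2 * (a α n).re * Real.exp (-(2 * Real.pi * n * y₀))

/-- `w(n) = arccos c(n)`; `Real.arccos` is `0` above `1` and `π` below `-1`. -/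
def w (α : ℂ) (y y₀ : ℝ) (n : ℕ) : ℝ := Real.arccos (c α y y₀ n)

end JInversion

end

noncomputable section

namespace JInversion

open UpperHalfPlane ModularForm MatrixGroups Function.Periodic Filter Topology

open scoped ComplexConjugate

/-! ### The `j`-function as a function of `q` -/

/-! Write e(t) = exp(2πit). The coefficient a(n) is entire in α, so z ↦ a(n) at α = j(z) is a
holomorphic modular function on the upper half-plane. Near the cusp it is e(-nz) + O(q), by
`norm_a_sub_le`. It is therefore natural to compare it with a Poincaré-type sum: e(-nz) plus the sum
over integers k of e(n/(z+k)), each term stripped of its constant and linear parts in 1/(z+k) so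
that the sum converges absolutely.

The difference, `remainder`, is periodic, vanishes at the cusp and is almost invariant under
inversion on the segment Im z = 1/2, |Re z| ≤ 1/2, with error O(n² exp(πn)). Inversion sends this
segment to Im ≥ 1, where the Schwarz lemma in q makes the function at most half its maximum on Im z
= 1/2. So `norm_le_of_norm_sub_inversion_le` bounds the remainder by twice the error. This is
`norm_a_j_sub_le`: only e(-nz), e(n/z), e(n/(z+1)), e(n/(z-1)) matter.

On the fundamental domain Im z ≥ √3/2 > 1/2, so on the scale exp(2πny) the error decays
exponentially. The surviving main term is e(-nx) if |z| > 1, 2cos(2πnx) on the open arc, and 3(-1)^n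
at the corner of order three. The statements on `b` follow from these asymptotics
(`exists_main_term`).

They also replace the usual facts about j. Since y is determined by α, comparison with the corner,
where E₄ vanishes, settles α = 0. The growth bound makes the power series converge for |q| <
exp(-2πy), and a differential equation then excludes poles of H there (`hasSum_Hq`). Finally, for α
≠ 0, c(n) is asymptotic to cos(2πnx), and the arccosines of two consecutive terms give x up to signs
and an integer (`recover_re`). -/

lemma Delta_eq_discriminant (τ : ℍ) : Delta τ = discriminant τ :=
  (discriminant_eq_E₄_cube_sub_E₆_sq τ).symm

/-- The function `q ↦ q j(q)` on the unit disc. -/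
def qj (q : ℂ) : ℂ :=
  cuspFunction 1 E₄ q ^ 3 / dslope (cuspFunction 1 discriminant) 0 q

lemma differentiableOn_cuspFunction_E {k : ℕ} (hk : 3 ≤ k) :
    DifferentiableOn ℂ (cuspFunction 1 (E hk)) (Metric.ball 0 1) := fun _ hq =>
  (ModularFormClass.differentiableAt_cuspFunction (E hk) one_pos one_mem_strictPeriods_SL
    (mem_ball_zero_iff.mp hq)).differentiableWithinAt

lemma differentiableOn_cuspFunction_discriminant :
    DifferentiableOn ℂ (cuspFunction 1 discriminant) (Metric.ball 0 1) := fun _ hq =>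
  (ModularFormClass.differentiableAt_cuspFunction CuspForm.discriminant one_pos
    one_mem_strictPeriods_SL (mem_ball_zero_iff.mp hq)).differentiableWithinAt

lemma cuspFunction_discriminant_zero : cuspFunction 1 discriminant 0 = 0 := by
  simpa using discriminant_cuspFunction_eqOn (Metric.mem_ball_self one_pos)

lemma exists_qParam_eq {q : ℂ} (hq : ‖q‖ < 1) (h0 : q ≠ 0) : ∃ τ : ℍ, qParam 1 τ = q :=
  ⟨⟨invQParam 1 q, im_invQParam_pos_of_norm_lt_one one_pos hq h0⟩,
    qParam_right_inv one_ne_zero h0⟩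

lemma cuspFunction_E_qParam {k : ℕ} (hk : 3 ≤ k) (τ : ℍ) :
    cuspFunction 1 (E hk) (qParam 1 τ) = E hk τ :=
  SlashInvariantFormClass.eq_cuspFunction (E hk) τ one_mem_strictPeriods_SL one_ne_zero

lemma cuspFunction_discriminant_qParam (τ : ℍ) :
    cuspFunction 1 discriminant (qParam 1 τ) = discriminant τ :=
  SlashInvariantFormClass.eq_cuspFunction CuspForm.discriminant τ one_mem_strictPeriods_SL
    one_ne_zero

lemma cuspFunction_E_zero {k : ℕ} (hk : 3 ≤ k) (hk2 : Even k) :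
    cuspFunction 1 (E hk) 0 = 1 := by
  simpa [qExpansion_coeff] using EisensteinSeries.E_qExpansion_coeff_zero hk hk2

lemma dslope_discriminant_ne_zero {q : ℂ} (hq : ‖q‖ < 1) :
    dslope (cuspFunction 1 discriminant) 0 q ≠ 0 := by
  rcases eq_or_ne q 0 with rfl | h0
  · have := discriminant_qExpansion_coeff_one
    simp [qExpansion_coeff] at this
    simp [this]
  · obtain ⟨τ, rfl⟩ := exists_qParam_eq hq h0
    rw [dslope_of_ne _ h0, slope_def_field, cuspFunction_discriminant_zero,
      cuspFunction_discriminant_qParam]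
    simpa using ⟨discriminant_ne_zero τ, h0⟩

lemma qj_zero : qj 0 = 1 := by
  have := discriminant_qExpansion_coeff_one
  simp only [qExpansion_coeff, Nat.factorial_one, Nat.cast_one, inv_one, iteratedDeriv_one,
    one_mul] at this
  simp [qj, this, cuspFunction_E_zero _ (by decide : Even 4)]

lemma differentiableOn_qj : DifferentiableOn ℂ qj (Metric.ball 0 1) := by
  refine ((differentiableOn_cuspFunction_E _).pow 3).div ?_ fun q hq =>
    dslope_discriminant_ne_zero (mem_ball_zero_iff.mp hq)
  exact (Complex.differentiableOn_dslope (Metric.ball_mem_nhds _ one_pos)).mpr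
    differentiableOn_cuspFunction_discriminant

lemma qParam_ne_zero' (τ : ℂ) : qParam 1 τ ≠ 0 := Complex.exp_ne_zero _

lemma j_eq_qj (τ : ℍ) : j τ = qj (qParam 1 τ) / qParam 1 τ := by
  rw [qj, dslope_of_ne _ (qParam_ne_zero' τ), slope_def_field, cuspFunction_discriminant_zero,
    cuspFunction_discriminant_qParam, cuspFunction_E_qParam, j, Delta_eq_discriminant, E4]
  have h1 := discriminant_ne_zero τ
  have h2 := qParam_ne_zero' τ
  field_simp
  simp

/-! ### Modularity -/

lemma qParam_vadd_one (τ : ℍ) : qParam 1 (((1 : ℝ) +ᵥ τ : ℍ) : ℂ) = qParam 1 τ := by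
  simp only [qParam, coe_vadd]
  rw [Complex.exp_eq_exp_iff_exists_int]
  exact ⟨1, by push_cast; ring⟩

lemma E_S_smul {k : ℕ} (hk : 3 ≤ k) (τ : ℍ) :
    E hk (ModularGroup.S • τ) = (τ : ℂ) ^ k * E hk τ := by
  have : SlashInvariantFormClass (ModularForm 𝒮ℒ k) (CongruenceSubgroup.Gamma 1) k :=
    CongruenceSubgroup.Gamma_one_coe_eq_SL ▸ inferInstance
  have h := SlashInvariantForm.slash_action_eqn_SL'' (E hk)
    (CongruenceSubgroup.mem_Gamma_one ModularGroup.S) τ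
  simpa [ModularGroup.denom_S] using h

lemma j_S_smul (τ : ℍ) : j (ModularGroup.S • τ) = j τ := by
  have h0 : (τ : ℂ) ≠ 0 := τ.ne_zero
  simp only [j, Delta, E4, E6, E_S_smul]
  rw [show ((τ : ℂ) ^ 4 * E (k := 4) (by norm_num) τ) ^ 3
      - ((τ : ℂ) ^ 6 * E (k := 6) (by norm_num) τ) ^ 2
      = (τ : ℂ) ^ 12 * (E (k := 4) (by norm_num) τ ^ 3 - E (k := 6) (by norm_num) τ ^ 2) by ring,
    mul_pow, ← pow_mul, mul_div_assoc _ _ (1728 : ℂ), mul_div_mul_left _ _ (pow_ne_zero _ h0)]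

/-! ### Complex conjugation -/

lemma hasSum_cuspFunction_E {k : ℕ} (hk : 3 ≤ k) {q : ℂ} (hq : ‖q‖ < 1) :
    HasSum (fun m : ℕ => (qExpansion 1 (E hk)).coeff m * q ^ m) (cuspFunction 1 (E hk) q) := by
  have h := Complex.hasSum_taylorSeries_on_ball (differentiableOn_cuspFunction_E hk)
    (show q ∈ Metric.ball 0 1 by simpa using hq)
  refine h.congr_fun fun m => ?_
  rw [qExpansion_coeff]
  simp
  ring

lemma conj_qExpansion_coeff_E {k : ℕ} (hk : 3 ≤ k) (hk2 : Even k) (m : ℕ) :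
    conj ((qExpansion 1 (E hk)).coeff m) = (qExpansion 1 (E hk)).coeff m := by
  rw [EisensteinSeries.E_qExpansion_coeff hk hk2]
  split_ifs <;> simp [map_ofNat]

lemma cuspFunction_E_conj {k : ℕ} (hk : 3 ≤ k) (hk2 : Even k) {q : ℂ} (hq : ‖q‖ < 1) :
    cuspFunction 1 (E hk) (conj q) = conj (cuspFunction 1 (E hk) q) := by
  have h1 := hasSum_cuspFunction_E hk (q := conj q) (by simpa using hq)
  have h2 := (hasSum_cuspFunction_E hk hq).map (starRingEnd ℂ) Complex.continuous_conj
  refine h1.unique (h2.congr_fun fun m => ?_)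
  simp [conj_qExpansion_coeff_E hk hk2]

lemma qj_conj {q : ℂ} (hq : ‖q‖ < 1) : qj (conj q) = conj (qj q) := by
  rcases eq_or_ne q 0 with rfl | h0
  · simp [qj_zero]
  have key : ∀ p : ℂ, ‖p‖ < 1 → p ≠ 0 → qj p = p * (cuspFunction 1 E₄ p ^ 3 /
      ((cuspFunction 1 E₄ p ^ 3 - cuspFunction 1 E₆ p ^ 2) / 1728)) := by
    intro p hp hp0
    obtain ⟨τ, rfl⟩ := exists_qParam_eq hp hp0
    have := j_eq_qj τ
    rw [cuspFunction_E_qParam, cuspFunction_E_qParam]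
    rw [eq_div_iff hp0] at this
    rw [← this, mul_comm]
    rfl
  rw [key q hq h0, key (conj q) (by simpa using hq) (by simpa using h0),
    cuspFunction_E_conj _ (by decide) hq, cuspFunction_E_conj _ (by decide) hq]
  simp [map_ofNat]

lemma qParam_neg_conj (τ : ℂ) : qParam 1 (-conj τ) = conj (qParam 1 τ) := by
  simp [qParam, ← Complex.exp_conj, map_ofNat]

/-- On the unit circle -1/τ is the reflection of τ in the imaginary axis, and this reflection
conjugates q. The function `qj` commutes with conjugation because E₄ and E₆ have real coefficients.
-/
lemma j_eq_conj_of_norm_eq_one {τ : ℍ} (hτ : ‖(τ : ℂ)‖ = 1) : conj (j τ) = j τ := by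
  have h : ((ModularGroup.S • τ : ℍ) : ℂ) = -conj (τ : ℂ) := by
    rw [modular_S_smul, coe_mk, Complex.inv_def]
    simp [Complex.normSq_eq_norm_sq, hτ]
  have := j_eq_qj (ModularGroup.S • τ)
  rwa [h, qParam_neg_conj, qj_conj (norm_qParam_lt_one one_pos τ.im_pos), ← map_div₀, ← j_eq_qj,
    j_S_smul, eq_comm] at this

/-! ### The elliptic point of order three -/

/-- Here ρ² + ρ + 1 = 0, so -1/ρ = ρ + 1. Weight 4 and periodicity give E₄(ρ) = ρ⁴E₄(ρ), where ρ⁴ =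
ρ ≠ 1. -/
lemma E4_eq_zero {ρ : ℍ} (hre : ρ.re = -(1 / 2)) (hn : ‖(ρ : ℂ)‖ = 1) : E4 ρ = 0 := by
  have hc : conj (ρ : ℂ) = -1 - ρ := by
    apply Complex.ext
    · simp only [Complex.conj_re, Complex.sub_re, Complex.neg_re, Complex.one_re, coe_re, hre]
      norm_num
    · simp
  have hnorm : (ρ : ℂ) * (-1 - ρ) = 1 := by
    rw [← hc, Complex.mul_conj, Complex.normSq_eq_norm_sq, hn]
    simp
  have hS : ModularGroup.S • ρ = (1 : ℝ) +ᵥ ρ := by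
    ext1
    rw [modular_S_smul, coe_mk, coe_vadd, Complex.ofReal_one]
    have h0 : (ρ : ℂ) ≠ 0 := ρ.ne_zero
    rw [inv_neg, eq_comm, ← sub_eq_zero]
    refine (mul_eq_zero.mp (?_ : (ρ : ℂ) * _ = 0)).resolve_left h0
    rw [mul_sub, mul_neg, mul_inv_cancel₀ h0]
    linear_combination -hnorm
  have h1 := E_S_smul (k := 4) (by norm_num) ρ
  rw [hS, ← cuspFunction_E_qParam, qParam_vadd_one, cuspFunction_E_qParam] at h1
  have h4 : (ρ : ℂ) ^ 4 - 1 ≠ 0 := by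
    have h3 : (ρ : ℂ) ^ 4 - 1 = ρ - 1 := by linear_combination (-(ρ : ℂ) ^ 2 + ρ) * hnorm
    rw [h3]
    intro h
    have := congrArg Complex.im h
    simp at this
    exact ρ.im_pos.ne' this
  refine (mul_eq_zero.mp (?_ : ((ρ : ℂ) ^ 4 - 1) * _ = 0)).resolve_left h4
  rw [E4, sub_mul, one_mul, ← h1, sub_self]

lemma j_eq_zero {ρ : ℍ} (hre : ρ.re = -(1 / 2)) (hn : ‖(ρ : ℂ)‖ = 1) : j ρ = 0 := by
  simp [j, E4_eq_zero hre hn]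

/-! ### The form `H` as a function of `q` and its Taylor coefficients -/

/-- The form `H α` as a function of `q`. -/
def Hq (α q : ℂ) : ℂ := (qj q - q * deriv qj q) / (qj q - α * q)

lemma differentiableAt_qj {q : ℂ} (hq : ‖q‖ < 1) : DifferentiableAt ℂ qj q :=
  differentiableOn_qj.differentiableAt (Metric.isOpen_ball.mem_nhds (mem_ball_zero_iff.mpr hq))

lemma analyticAt_qj {q : ℂ} (hq : ‖q‖ < 1) : AnalyticAt ℂ qj q :=
  differentiableOn_qj.analyticAt (Metric.isOpen_ball.mem_nhds (mem_ball_zero_iff.mpr hq))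

lemma analyticAt_Hq (α : ℂ) {q : ℂ} (hq : ‖q‖ < 1) (h : qj q - α * q ≠ 0) :
    AnalyticAt ℂ (Hq α) q := by
  have h1 := analyticAt_qj hq
  have h2 := h1.deriv
  exact (h1.sub (analyticAt_id.mul h2)).div (h1.sub (analyticAt_const.mul analyticAt_id)) h

lemma analyticAt_Hq_zero (α : ℂ) : AnalyticAt ℂ (Hq α) 0 :=
  analyticAt_Hq α (by simp) (by simp [qj_zero])

lemma H_eq_Hq (α : ℂ) (τ : ℍ) : H α τ = Hq α (qParam 1 τ) := by
  set q := qParam 1 (τ : ℂ) with hqdef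
  have hq0 : q ≠ 0 := qParam_ne_zero' τ
  have hq1 : ‖q‖ < 1 := norm_qParam_lt_one one_pos τ.im_pos
  have hd : HasDerivAt (fun z : ℂ => qParam 1 z) (2 * Real.pi * Complex.I * q) τ := by
    have h : HasDerivAt (fun z : ℂ => qParam 1 z) _ τ :=
      (((hasDerivAt_id (τ : ℂ)).const_mul (2 * Real.pi * Complex.I)).div_const
        ((1 : ℝ) : ℂ)).cexp
    refine h.congr_deriv ?_
    simp only [hqdef, qParam, id, Complex.ofReal_one]
    ring
  have hJ : HasDerivAt (fun z : ℂ => qj (qParam 1 z) / qParam 1 z)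
      (((deriv qj q * (2 * Real.pi * Complex.I * q)) * q - qj q * (2 * Real.pi * Complex.I * q)) /
        q ^ 2) τ := by
    have h1 : HasDerivAt qj (deriv qj q) (qParam 1 (τ : ℂ)) := (differentiableAt_qj hq1).hasDerivAt
    exact HasDerivAt.fun_div (h1.comp (τ : ℂ) hd) hd hq0
  have hev : j ∘ ofComplex =ᶠ[𝓝 (τ : ℂ)] fun z : ℂ => qj (qParam 1 z) / qParam 1 z := by
    filter_upwards [isOpen_upperHalfPlaneSet.mem_nhds τ.im_pos] with z hz
    simp only [Function.comp_apply, ofComplex_apply_of_im_pos hz, j_eq_qj]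
  rw [H, hev.deriv_eq, hJ.deriv, Hq, j_eq_qj, ← hqdef]
  have hpi : (Real.pi : ℂ) ≠ 0 := by exact_mod_cast Real.pi_ne_zero
  have hI := Complex.I_ne_zero
  rw [show qj q / q - α = (qj q - α * q) / q by field_simp]
  by_cases h0 : qj q - α * q = 0
  · simp [h0]
  · field_simp
    ring

lemma cuspFunction_H_eventuallyEq (α : ℂ) : cuspFunction 1 (H α) =ᶠ[𝓝 0] Hq α := by
  have hne : ∀ q : ℂ, ‖q‖ < 1 → q ≠ 0 → cuspFunction 1 (H α) q = Hq α q := by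
    intro q hq h0
    have him := im_invQParam_pos_of_norm_lt_one one_pos hq h0
    rw [UpperHalfPlane.cuspFunction, cuspFunction_eq_of_nonzero 1 _ h0, Function.comp_apply,
      ofComplex_apply_of_im_pos him, H_eq_Hq, coe_mk, qParam_right_inv one_ne_zero h0]
  have hball : ∀ᶠ q : ℂ in 𝓝[≠] 0, cuspFunction 1 (H α) q = Hq α q := by
    filter_upwards [nhdsWithin_le_nhds (Metric.ball_mem_nhds (0 : ℂ) one_pos),
      self_mem_nhdsWithin] with q hq h0
    exact hne q (by simpa using hq) h0
  have h0 : cuspFunction 1 (H α) 0 = Hq α 0 := by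
    rw [UpperHalfPlane.cuspFunction, cuspFunction_zero_eq_limUnder_nhds_ne]
    refine Tendsto.limUnder_eq (Tendsto.congr' (hball.mono fun q hq => hq.symm) ?_)
    exact (analyticAt_Hq_zero α).continuousAt.tendsto.mono_left nhdsWithin_le_nhds
  filter_upwards [Metric.ball_mem_nhds (0 : ℂ) one_pos] with q hq
  rcases eq_or_ne q 0 with rfl | hq0
  · exact h0
  · exact hne q (by simpa using hq) hq0

lemma a_eq (α : ℂ) (n : ℕ) : a α n = (n.factorial : ℂ)⁻¹ * iteratedDeriv n (Hq α) 0 := by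
  rw [a, qExpansion_coeff, (cuspFunction_H_eventuallyEq α).iteratedDeriv_eq]

/-- This is the Leibniz rule for (`qj` - αq) · `Hq` = `qj` - q `qj`', solved for the top derivative
because `qj` is 1 at 0. It exhibits every coefficient as a polynomial in α. -/
lemma iteratedDeriv_Hq_recursion (α : ℂ) (n : ℕ) :
    iteratedDeriv n (Hq α) 0 = iteratedDeriv n (fun q => qj q - q * deriv qj q) 0 -
      ∑ i ∈ Finset.range n, (n.choose (i + 1)) *
        (iteratedDeriv (i + 1) qj 0 - α * iteratedDeriv (i + 1) id 0) *
        iteratedDeriv (n - (i + 1)) (Hq α) 0 := by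
  have hqj : AnalyticAt ℂ qj 0 := analyticAt_qj (by simp)
  have hf : AnalyticAt ℂ (fun q => qj q - α * id q) 0 :=
    hqj.sub (analyticAt_const.mul analyticAt_id)
  have hfn : ∀ i, iteratedDeriv i (fun q => qj q - α * id q) 0
      = iteratedDeriv i qj 0 - α * iteratedDeriv i id 0 := by
    intro i
    have h2 : ContDiffAt ℂ i (fun q : ℂ => α * id q) 0 :=
      (analyticAt_const.mul analyticAt_id).contDiffAt
    rw [iteratedDeriv_fun_sub hqj.contDiffAt h2, iteratedDeriv_const_mul_field]
  have hmul : (fun q => qj q - α * id q) * Hq α =ᶠ[𝓝 0] fun q => qj q - q * deriv qj q := by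
    have : ∀ᶠ q in 𝓝 (0 : ℂ), qj q - α * id q ≠ 0 :=
      hf.continuousAt.eventually_ne (by simp [qj_zero])
    filter_upwards [this] with q hq
    simp only [id] at hq
    simp [Hq, mul_div_cancel₀ _ hq]
  rw [← hmul.iteratedDeriv_eq, iteratedDeriv_mul hf.contDiffAt (analyticAt_Hq_zero α).contDiffAt,
    Finset.sum_range_succ']
  simp only [hfn]
  simp only [iteratedDeriv_zero, qj_zero, Nat.choose_zero_right, Nat.cast_one, one_mul,
    id, mul_zero, sub_zero, Nat.sub_zero, add_sub_cancel_left]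

lemma differentiable_iteratedDeriv_Hq (n : ℕ) :
    Differentiable ℂ fun α => iteratedDeriv n (Hq α) 0 := by
  induction n using Nat.strong_induction_on with
  | _ n ih =>
    rw [funext fun α => iteratedDeriv_Hq_recursion α n]
    refine (differentiable_const _).sub (Differentiable.fun_sum fun i hi => ?_)
    have := ih (n - (i + 1)) (by have := Finset.mem_range.mp hi; omega)
    fun_prop

lemma differentiable_a (n : ℕ) : Differentiable ℂ fun α => a α n := by
  simp only [a_eq]
  exact (differentiable_iteratedDeriv_Hq n).const_mul _

/-! ### Reality of the coefficients -/

lemma iteratedDeriv_conj_conj (f : ℂ → ℂ) (n : ℕ) :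
    iteratedDeriv n (conj ∘ f ∘ conj) = conj ∘ iteratedDeriv n f ∘ conj := by
  induction n with
  | zero => simp
  | succ n ih =>
    rw [iteratedDeriv_succ, ih, iteratedDeriv_succ]
    funext x
    simp [deriv_conj_conj]

lemma conj_iteratedDeriv_zero {f : ℂ → ℂ} (hf : ∀ᶠ q in 𝓝 0, f (conj q) = conj (f q)) (n : ℕ) :
    conj (iteratedDeriv n f 0) = iteratedDeriv n f 0 := by
  have h : conj ∘ f ∘ conj =ᶠ[𝓝 0] f := by
    filter_upwards [hf] with q hq
    simp [hq]
  have h1 := h.iteratedDeriv_eq n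
  rw [iteratedDeriv_conj_conj] at h1
  simpa using h1

lemma deriv_qj_conj {q : ℂ} (hq : ‖q‖ < 1) : deriv qj (conj q) = conj (deriv qj q) := by
  have h : conj ∘ qj ∘ conj =ᶠ[𝓝 q] qj := by
    filter_upwards [Metric.isOpen_ball.mem_nhds (mem_ball_zero_iff.mpr hq)] with p hp
    simp [qj_conj (mem_ball_zero_iff.mp hp)]
  have h1 := h.deriv_eq
  rw [deriv_conj_conj] at h1
  simp [← h1]

lemma conj_a {α : ℂ} (hα : conj α = α) (n : ℕ) : conj (a α n) = a α n := by
  rw [a_eq, map_mul, map_inv₀, map_natCast, conj_iteratedDeriv_zero]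
  filter_upwards [Metric.ball_mem_nhds (0 : ℂ) one_pos] with q hq
  have hq : ‖q‖ < 1 := by simpa using hq
  simp [Hq, qj_conj hq, deriv_qj_conj hq, hα]

/-! ### Behaviour of the coefficients at the cusp -/

lemma iteratedDeriv_div_sub {p : ℂ} (hp : p ≠ 0) (n : ℕ) :
    iteratedDeriv n (fun q => p / (p - q)) 0 = n.factorial * (p ^ n)⁻¹ := by
  induction n with
  | zero => simp [hp]
  | succ n ih =>
    have hf : AnalyticAt ℂ (fun q : ℂ => p - q) 0 := analyticAt_const.sub analyticAt_id
    have hg : AnalyticAt ℂ (fun q : ℂ => p / (p - q)) 0 :=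
      analyticAt_const.div hf (by simpa using hp)
    have hmul : (fun q : ℂ => p - q) * (fun q : ℂ => p / (p - q)) =ᶠ[𝓝 0] fun _ => p := by
      filter_upwards [hf.continuousAt.eventually_ne (by simpa using hp)] with q hq
      simp [mul_div_cancel₀ _ hq]
    have h := hmul.iteratedDeriv_eq (n + 1)
    have hd1 : iteratedDeriv 1 (fun q : ℂ => p - q) 0 = -1 := by
      simp [iteratedDeriv_one]
    have hd2 : ∀ i : ℕ, iteratedDeriv (i + 2) (fun q : ℂ => p - q) 0 = 0 := by
      intro i
      rw [iteratedDeriv_succ', show deriv (fun q : ℂ => p - q) = fun _ => -1 by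
        funext x; simp]
      simp [iteratedDeriv_const]
    rw [iteratedDeriv_mul hf.contDiffAt hg.contDiffAt, Finset.sum_range_succ',
      Finset.sum_range_succ', iteratedDeriv_const] at h
    simp only [hd2, zero_add, hd1, ih, mul_zero, zero_mul, Finset.sum_const_zero,
      Nat.choose_one_right, Nat.choose_zero_right, iteratedDeriv_zero, Nat.add_sub_cancel,
      Nat.sub_zero, sub_zero, Nat.cast_one, one_mul, Nat.add_eq_zero_iff, one_ne_zero, and_false,
      if_false] at h
    rw [Nat.factorial_succ]
    refine mul_left_cancel₀ hp ?_
    field_simp at h ⊢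
    push_cast at h ⊢
    linear_combination h

lemma exists_bound_dslope_qj : ∃ G : ℝ, 0 ≤ G ∧
    ∀ q ∈ Metric.closedBall (0 : ℂ) (1 / 2), ‖deriv (dslope qj 0) q‖ ≤ G := by
  have hg : DifferentiableOn ℂ (dslope qj 0) (Metric.ball 0 1) :=
    (Complex.differentiableOn_dslope (Metric.ball_mem_nhds _ one_pos)).mpr differentiableOn_qj
  have hc : ContinuousOn (deriv (dslope qj 0)) (Metric.closedBall 0 (1 / 2)) :=
    (hg.deriv Metric.isOpen_ball).continuousOn.mono
      (Metric.closedBall_subset_ball (by norm_num))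
  obtain ⟨G, hG⟩ := (isCompact_closedBall (0 : ℂ) (1 / 2)).exists_bound_of_continuousOn hc
  exact ⟨G, (norm_nonneg _).trans (hG 0 (by simp)), hG⟩

/-- For `α = j(p)` with `p` small, the `n`-th coefficient is `p⁻ⁿ + O(p)`. -/
theorem norm_a_sub_le (n : ℕ) : ∃ r C : ℝ, 0 < r ∧ r ≤ 1 ∧ ∀ p : ℂ, p ≠ 0 → ‖p‖ ≤ r →
    ‖a (qj p / p) n - (p ^ n)⁻¹‖ ≤ C * ‖p‖ := by
  obtain ⟨G, hG0, hG⟩ := exists_bound_dslope_qj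
  set g := dslope qj 0 with hgdef
  have hg : DifferentiableOn ℂ g (Metric.ball 0 1) :=
    (Complex.differentiableOn_dslope (Metric.ball_mem_nhds _ one_pos)).mpr differentiableOn_qj
  have hgat : ∀ q : ℂ, ‖q‖ < 1 → DifferentiableAt ℂ g q := fun q hq =>
    hg.differentiableAt (Metric.isOpen_ball.mem_nhds (by simpa using hq))
  have hqjg : ∀ q : ℂ, qj q = 1 + q * g q := by
    intro q
    have := sub_smul_dslope qj 0 q
    rw [qj_zero, sub_zero, smul_eq_mul] at this
    rw [hgdef, this]; ring
  have hqj' : ∀ q : ℂ, ‖q‖ < 1 → deriv qj q = g q + q * deriv g q := by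
    intro q hq
    have h1 : HasDerivAt (fun q => 1 + q * g q) (1 * g q + q * deriv g q) q :=
      ((hasDerivAt_id q).mul (hgat q hq).hasDerivAt).const_add 1
    rw [show qj = fun q => 1 + q * g q from funext hqjg, h1.deriv, one_mul]
  -- This radius depends neither on p nor on n; it makes |pqs(q)| ≤ 1/2 for |q| ≤ r, so the
  -- denominator below stays away from 0.
  set r : ℝ := 1 / (2 * (G + 1)) with hr
  have hr0 : 0 < r := by positivity
  have hr2 : r ≤ 1 / 2 := by
    rw [hr]; apply one_div_le_one_div_of_le <;> linarith
  have hrG : r * (G + 1) = 1 / 2 := by rw [hr]; field_simp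
  -- Taking |p| ≤ r/2 keeps p at distance at least r/2 from the circle |q| = r, where Cauchy's
  -- estimate is applied.
  refine ⟨r / 2, 8 * r * G / r ^ n, by positivity, by linarith, fun p hp0 hp => ?_⟩
  have hp1 : ‖p‖ < 1 := by linarith
  have hpr : p ∈ Metric.closedBall (0 : ℂ) (1 / 2) := by simp; linarith
  set s := dslope g p with hs
  have hpn : Metric.ball (0 : ℂ) 1 ∈ 𝓝 p := Metric.isOpen_ball.mem_nhds (by simpa using hp1)
  have hsd : DifferentiableOn ℂ s (Metric.ball 0 1) :=
    (Complex.differentiableOn_dslope hpn).mpr hg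
  have hsG : ∀ q : ℂ, ‖q‖ ≤ r → ‖s q‖ ≤ G := by
    intro q hq
    have hqr : q ∈ Metric.closedBall (0 : ℂ) (1 / 2) := by simp; linarith
    rcases eq_or_ne q p with rfl | hqp
    · rw [hs, dslope_same]; exact hG _ hqr
    · rw [hs, dslope_of_ne _ hqp, slope_def_field, norm_div,
        div_le_iff₀ (norm_pos_iff.mpr (sub_ne_zero.mpr hqp))]
      refine (convex_closedBall (0 : ℂ) (1 / 2)).norm_image_sub_le_of_norm_deriv_le
        (fun x hx => hgat x ?_) hG hpr hqr
      have : ‖x‖ ≤ 1 / 2 := by simpa using hx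
      linarith
  -- Subtracting p/(p - q) from `Hq` leaves pq k(q) / ((p - q)(1 - pqs(q))). As k(p) = 0, the pole
  -- at q = p cancels and Φ below is what remains; its factor p gives the error O(p).
  set k : ℂ → ℂ := fun q => p * s q - q * deriv g q with hk
  have hkd : DifferentiableOn ℂ k (Metric.ball 0 1) :=
    (hsd.const_mul p).sub (differentiableOn_id.mul (hg.deriv Metric.isOpen_ball))
  have hkp : k p = 0 := by simp [hk, hs]
  set d := dslope k p with hd
  have hdd : DifferentiableOn ℂ d (Metric.ball 0 1) :=
    (Complex.differentiableOn_dslope hpn).mpr hkd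
  have hdk : ∀ q, (q - p) * d q = k q := by
    intro q
    have := sub_smul_dslope k p q
    rwa [hkp, sub_zero, smul_eq_mul] at this
  have hden : ∀ q : ℂ, ‖q‖ ≤ r → 1 / 2 ≤ ‖1 - p * q * s q‖ := by
    intro q hq
    have h1 : ‖p * q * s q‖ ≤ 1 / 2 := by
      rw [norm_mul, norm_mul]
      calc ‖p‖ * ‖q‖ * ‖s q‖ ≤ 1 * r * G := by
            gcongr
            exact hsG q hq
        _ ≤ 1 / 2 := by nlinarith
    have h2 := norm_sub_norm_le (1 : ℂ) (p * q * s q)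
    rw [norm_one] at h2
    linarith
  have hden0 : ∀ q : ℂ, ‖q‖ ≤ r → 1 - p * q * s q ≠ 0 := fun q hq h => by
    have := hden q hq
    rw [h, norm_zero] at this
    linarith
  set Φ : ℂ → ℂ := fun q => -(p * q * d q) / (1 - p * q * s q) with hΦ
  have hΦd : DifferentiableOn ℂ Φ (Metric.closedBall 0 r) := by
    have hsub : Metric.closedBall (0 : ℂ) r ⊆ Metric.ball 0 1 :=
      Metric.closedBall_subset_ball (by linarith)
    refine DifferentiableOn.div ?_ ?_ fun q hq => hden0 q (by simpa using hq)
    · exact ((differentiableOn_id.const_mul p).mul (hdd.mono hsub)).neg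
    · exact (differentiableOn_const 1).sub ((differentiableOn_id.const_mul p).mul (hsd.mono hsub))
  have hΦb : ∀ q ∈ Metric.sphere (0 : ℂ) r, ‖Φ q‖ ≤ 8 * r * G * ‖p‖ := by
    intro q hq
    have hq : ‖q‖ = r := by simpa using hq
    have hkb : ‖k q‖ ≤ 2 * r * G := by
      calc ‖k q‖ ≤ ‖p‖ * ‖s q‖ + ‖q‖ * ‖deriv g q‖ := by
            simpa [hk] using norm_sub_le (p * s q) (q * deriv g q)
        _ ≤ r * G + r * G := by
            gcongr
            · linarith
            · exact hsG q hq.le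
            · exact hq.le
            · exact hG q (by simp; linarith)
        _ = 2 * r * G := by ring
    have hqp : r / 2 ≤ ‖q - p‖ := by
      have := norm_sub_norm_le q p
      linarith
    have hdb : ‖d q‖ ≤ 4 * G := by
      have h1 : ‖q - p‖ * ‖d q‖ ≤ 2 * r * G := by rw [← norm_mul, hdk]; exact hkb
      have h2 : r / 2 * ‖d q‖ ≤ 2 * r * G :=
        (mul_le_mul_of_nonneg_right hqp (norm_nonneg _)).trans h1
      have h3 : r * ‖d q‖ ≤ r * (4 * G) := by linarith
      exact le_of_mul_le_mul_left h3 hr0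
    rw [hΦ]
    simp only [norm_div, norm_neg, norm_mul, hq]
    rw [div_le_iff₀ (by linarith [hden q hq.le])]
    calc ‖p‖ * r * ‖d q‖ ≤ ‖p‖ * r * (4 * G) := by gcongr
      _ = 8 * r * G * ‖p‖ * (1 / 2) := by ring
      _ ≤ _ := by gcongr; exact hden q hq.le
  have hcauchy := Complex.norm_iteratedDeriv_le_of_forall_mem_sphere_norm_le n hr0
    (hΦd.diffContOnCl_ball subset_rfl) hΦb
  have hpn0 : 0 < ‖p‖ := norm_pos_iff.mpr hp0
  have hev : Hq (qj p / p) =ᶠ[𝓝 0] fun q => p / (p - q) + Φ q := by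
    filter_upwards [Metric.ball_mem_nhds (0 : ℂ) hpn0] with q hq
    have hq : ‖q‖ < ‖p‖ := by simpa using hq
    have hne : p - q ≠ 0 := by
      intro h
      rw [sub_eq_zero.mp h] at hq
      exact lt_irrefl _ hq
    have hden' := hden0 q (by linarith)
    have hs' : g q - g p = (q - p) * s q := (sub_smul_dslope g p q).symm
    have hd' : (q - p) * d q = p * s q - q * deriv g q := hdk q
    have hnum : qj q - q * deriv qj q = 1 - q ^ 2 * deriv g q := by
      rw [hqjg, hqj' q (by linarith)]; ring
    have hde : qj q - qj p / p * q = (p - q) * (1 - p * q * s q) / p := by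
      rw [hqjg, hqjg p]
      field_simp
      linear_combination (p * q) * hs'
    rw [Hq, hnum, hde, hΦ]
    rw [div_div_eq_mul_div, div_add_div _ _ hne hden']
    congr 1
    linear_combination (-p * q) * hd'
  have hΦan : AnalyticAt ℂ Φ 0 := hΦd.analyticAt (Metric.closedBall_mem_nhds _ hr0)
  have hgeom : AnalyticAt ℂ (fun q : ℂ => p / (p - q)) 0 :=
    analyticAt_const.div (analyticAt_const.sub analyticAt_id) (by simpa using hp0)
  rw [a_eq, hev.iteratedDeriv_eq, iteratedDeriv_fun_add hgeom.contDiffAt hΦan.contDiffAt,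
    iteratedDeriv_div_sub hp0, mul_add, inv_mul_cancel_left₀ (by exact_mod_cast n.factorial_ne_zero),
    add_sub_cancel_left, norm_mul, norm_inv, Complex.norm_natCast]
  have hf : (0 : ℝ) < n.factorial := by exact_mod_cast n.factorial_pos
  rw [inv_mul_le_iff₀ hf]
  refine hcauchy.trans (le_of_eq ?_)
  ring

/-! ### A contraction principle on the upper half-plane -/

lemma abs_re_invQParam_le (q : ℂ) : |(invQParam 1 q).re| ≤ 1 / 2 := by
  have h : (invQParam 1 q).re = q.arg / (2 * Real.pi) := by
    have : invQParam 1 q = Complex.log q * (-Complex.I) / ((2 * Real.pi : ℝ) : ℂ) := by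
      rw [invQParam]
      have hpi : (Real.pi : ℂ) ≠ 0 := by exact_mod_cast Real.pi_ne_zero
      have hI := Complex.I_ne_zero
      push_cast
      field_simp
      simp
    rw [this, Complex.div_ofReal_re]
    simp [Complex.log_im]
  rw [h, abs_div, abs_of_pos Real.two_pi_pos, div_le_iff₀ Real.two_pi_pos]
  have := Complex.abs_arg_le_pi q
  linarith

/-- A periodic holomorphic function on the upper half-plane that vanishes at the cusp and is almost
invariant under `z ↦ -1 / z` on the segment `Im z = 1 / 2`, `|Re z| ≤ 1 / 2` is small. -/
theorem norm_le_of_norm_sub_inversion_le {R : ℂ → ℂ} {E : ℝ}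
    (hd : ∀ z : ℂ, 0 < z.im → DifferentiableAt ℂ R z) (hper : Function.Periodic R 1)
    (h0 : Tendsto R (comap Complex.im atTop) (𝓝 0))
    (hE : ∀ z : ℂ, z.im = 1 / 2 → |z.re| ≤ 1 / 2 → ‖R z - R (-1 / z)‖ ≤ E)
    {z : ℂ} (hz : 1 / 2 ≤ z.im) : ‖R z‖ ≤ 2 * E := by
  have hper' : Function.Periodic R ((1 : ℝ) : ℂ) := by simpa using hper
  set c := Function.Periodic.cuspFunction 1 R with hc
  have hcR : ∀ z, c (qParam 1 z) = R z := fun z => eq_cuspFunction one_ne_zero hper' z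
  have hcd : DifferentiableOn ℂ c (Metric.ball 0 1) := by
    intro q hq
    have hq : ‖q‖ < 1 := by simpa using hq
    refine DifferentiableAt.differentiableWithinAt ?_
    rcases eq_or_ne q 0 with rfl | hq0
    · refine differentiableAt_cuspFunction_zero one_pos hper' ?_ (h0.isBigO_one ℝ)
      filter_upwards [preimage_mem_comap (Ioi_mem_atTop 0)] with z hz using hd z hz
    · rw [← qParam_right_inv one_ne_zero hq0]
      exact Function.Periodic.differentiableAt_cuspFunction one_ne_zero hper'
        (hd _ (im_invQParam_pos_of_norm_lt_one one_pos hq hq0))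
  have hc0 : c 0 = 0 := cuspFunction_zero_of_zero_at_inf one_pos h0
  -- The line Im z = 1/2 corresponds to the circle |q| = r.
  set r := Real.exp (-Real.pi) with hr
  have hr0 : 0 < r := Real.exp_pos _
  have hr2 : r ≤ 1 / 2 := by
    have h1 := Real.add_one_le_exp Real.pi
    have h2 := Real.pi_gt_three
    rw [hr, Real.exp_neg, ← one_div]
    exact one_div_le_one_div_of_le (by norm_num) (by linarith)
  have hsub : Metric.closedBall (0 : ℂ) r ⊆ Metric.ball 0 1 :=
    Metric.closedBall_subset_ball (by linarith)
  have hcd' : DifferentiableOn ℂ c (Metric.closedBall 0 r) := hcd.mono hsub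
  obtain ⟨q₀, hq₀, hmax⟩ := (isCompact_sphere (0 : ℂ) r).exists_isMaxOn
    (NormedSpace.sphere_nonempty.mpr hr0.le)
    (hcd'.continuousOn.norm.mono Metric.sphere_subset_closedBall)
  set M := ‖c q₀‖ with hM
  have hball : ∀ q ∈ Metric.closedBall (0 : ℂ) r, ‖c q‖ ≤ M := by
    intro q hq
    refine Complex.norm_le_of_forall_mem_frontier_norm_le Metric.isBounded_ball
      (hcd'.diffContOnCl_ball subset_rfl) (fun x hx => ?_)
      (by rwa [closure_ball (0 : ℂ) hr0.ne'])
    rw [frontier_ball (0 : ℂ) hr0.ne'] at hx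
    exact hmax hx
  have hschwarz : ∀ q : ℂ, ‖q‖ < r → ‖c q‖ ≤ M / r * ‖q‖ := by
    intro q hq
    have := Complex.dist_le_div_mul_dist_of_mapsTo_ball (f := c) (c := 0) (R₁ := r) (R₂ := M)
      (hcd'.mono Metric.ball_subset_closedBall)
      (fun x hx => by simpa [hc0] using hball x (Metric.ball_subset_closedBall hx))
      (by simpa using hq)
    simpa [hc0] using this
  have hq₀n : ‖q₀‖ = r := by simpa using hq₀
  have hq₀0 : q₀ ≠ 0 := norm_pos_iff.mp (hq₀n ▸ hr0)
  -- At a maximum point w one has |w|² ≤ 1/2, hence Im(-1/w) ≥ 1 and |q(-1/w)| ≤ r². The Schwarz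
  -- bound gives |R(-1/w)| ≤ Mr ≤ M/2, so M ≤ E + M/2.
  have hMle : M ≤ 2 * E := by
    set w := invQParam 1 q₀ with hw
    have hwq : qParam 1 w = q₀ := qParam_right_inv one_ne_zero hq₀0
    have him : w.im = 1 / 2 := by
      rw [hw, im_invQParam, hq₀n, hr, Real.log_exp]
      have := Real.pi_ne_zero
      field_simp
    have hre : |w.re| ≤ 1 / 2 := abs_re_invQParam_le q₀
    have hw2 : Complex.normSq w ≤ 1 / 2 := by
      rw [Complex.normSq_apply, him]
      have := abs_le.mp hre
      nlinarith
    have hw2' : 0 < Complex.normSq w := by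
      rw [Complex.normSq_apply, him]; nlinarith [mul_self_nonneg w.re]
    have him' : 1 ≤ (-1 / w).im := by
      rw [neg_div, one_div, Complex.neg_im, Complex.inv_im, him, neg_div, neg_neg,
        le_div_iff₀ hw2']
      linarith
    have hqn : ‖qParam 1 (-1 / w)‖ ≤ r * r := by
      rw [norm_qParam, hr, ← Real.exp_add]
      apply Real.exp_le_exp.mpr
      have := Real.pi_pos
      rw [div_one]
      nlinarith
    have h1 := hE w him hre
    have h2 := hschwarz (qParam 1 (-1 / w)) (by nlinarith)
    rw [hcR] at h2
    have h3 : ‖R w‖ = M := by rw [← hcR, hwq]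
    have h4 := norm_sub_norm_le (R w) (R (-1 / w))
    have hM0 : 0 ≤ M := norm_nonneg _
    have h5 : M / r * ‖qParam 1 (-1 / w)‖ ≤ M * (1 / 2) := by
      calc M / r * ‖qParam 1 (-1 / w)‖ ≤ M / r * (r * r) := by gcongr
        _ = M * r := by field_simp
        _ ≤ _ := by gcongr
    linarith
  rw [← hcR]
  refine (hball _ ?_).trans hMle
  rw [mem_closedBall_zero_iff, norm_qParam, hr]
  apply Real.exp_le_exp.mpr
  have := Real.pi_pos
  rw [div_one]
  nlinarith

/-! ### A periodic series of exponentials -/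

lemma norm_exp_sub_one_sub_id_le_mul_exp {u : ℂ} (hu : 0 ≤ u.re) :
    ‖Complex.exp u - 1 - u‖ ≤ 3 * ‖u‖ ^ 2 * Real.exp u.re := by
  have he : 1 ≤ Real.exp u.re := Real.one_le_exp hu
  rcases le_or_gt ‖u‖ 1 with h | h
  · refine (Complex.norm_exp_sub_one_sub_id_le h).trans ?_
    nlinarith [sq_nonneg ‖u‖]
  · have h1 : ‖Complex.exp u - 1 - u‖ ≤ Real.exp u.re + 1 + ‖u‖ := by
      refine (norm_sub_le _ _).trans (add_le_add_left ((norm_sub_le _ _).trans ?_) _)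
      simp [Complex.norm_exp]
    nlinarith [mul_nonneg (sub_nonneg.mpr h.le) (sub_nonneg.mpr he), sq_nonneg ‖u‖,
      mul_pos (sub_pos.mpr h) (Real.exp_pos u.re)]

/-- The exponential `exp(2πin / w)` without its terms of order `0` and `1` in `1 / w`. -/
def expTail (n : ℕ) (w : ℂ) : ℂ :=
  Complex.exp (2 * Real.pi * Complex.I * n / w) - 1 - 2 * Real.pi * Complex.I * n / w

lemma re_two_pi_I_div (n : ℕ) (w : ℂ) :
    (2 * Real.pi * Complex.I * n / w).re = 2 * Real.pi * n * (w.im / ‖w‖ ^ 2) := by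
  rw [div_eq_mul_inv, show (2 * Real.pi * Complex.I * n : ℂ) * w⁻¹
    = ((2 * Real.pi * n : ℝ) : ℂ) * (Complex.I * w⁻¹) by push_cast; ring, Complex.re_ofReal_mul,
    Complex.I_mul_re, Complex.inv_im, Complex.normSq_eq_norm_sq]
  ring

lemma norm_two_pi_I_div (n : ℕ) (w : ℂ) :
    ‖2 * Real.pi * Complex.I * n / w‖ = 2 * Real.pi * n / ‖w‖ := by
  simp [abs_of_pos Real.pi_pos]

lemma norm_expTail_le (n : ℕ) {w : ℂ} (hw : 0 < w.im) :
    ‖expTail n w‖ ≤ 3 * (2 * Real.pi * n / ‖w‖) ^ 2 *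
      Real.exp (2 * Real.pi * n * (w.im / ‖w‖ ^ 2)) := by
  have := norm_exp_sub_one_sub_id_le_mul_exp (u := 2 * Real.pi * Complex.I * n / w) (by
    rw [re_two_pi_I_div]
    have := Real.pi_pos
    positivity)
  rwa [re_two_pi_I_div, norm_two_pi_I_div] at this

lemma ne_zero_of_im_pos {w : ℂ} (hw : 0 < w.im) : w ≠ 0 := by
  rintro rfl
  simp at hw

lemma differentiableAt_expTail (n : ℕ) {w : ℂ} (hw : w ≠ 0) :
    DifferentiableAt ℂ (expTail n) w := by
  have : DifferentiableAt ℂ (fun w : ℂ => 2 * Real.pi * Complex.I * n / w) w :=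
    (differentiableAt_const _).div differentiableAt_id hw
  exact (this.cexp.sub_const 1).sub this

lemma tendsto_expTail (n : ℕ) (k : ℤ) :
    Tendsto (fun z : ℂ => expTail n (z + k)) (comap Complex.im atTop) (𝓝 0) := by
  have h1 : Tendsto (fun z : ℂ => 2 * Real.pi * Complex.I * n / (z + k)) (comap Complex.im atTop)
      (𝓝 0) := by
    rw [tendsto_zero_iff_norm_tendsto_zero]
    simp only [norm_two_pi_I_div]
    refine Tendsto.const_div_atTop (tendsto_atTop_mono (fun z => ?_) tendsto_comap) _
    calc z.im ≤ |(z + k).im| := by simpa using le_abs_self z.im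
      _ ≤ _ := Complex.abs_im_le_norm _
  have h2 : Continuous fun u : ℂ => Complex.exp u - 1 - u := by fun_prop
  have h3 := (h2.tendsto 0).comp h1
  simp only [Complex.exp_zero, sub_self] at h3
  exact h3

/-- The translates `z - 1`, `z`, `z + 1` that are not far away from a point of the strip
`|Re z| ≤ 1`. -/
def nearTranslates : Finset ℤ := {-1, 0, 1}

lemma two_le_abs_of_notMem_nearTranslates {k : ℤ} (hk : k ∉ nearTranslates) : 2 ≤ |k| := by
  simp only [nearTranslates, Finset.mem_insert, Finset.mem_singleton, not_or] at hk
  by_contra! h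
  have := abs_lt.mp h
  omega

/-- The bound for the sum over the far translates. -/
def farConst : ℝ := 48 * Real.pi ^ 2 * ∑' k : {k : ℤ // k ∉ nearTranslates}, 1 / (k : ℝ) ^ 2

lemma farConst_nonneg : 0 ≤ farConst :=
  mul_nonneg (by positivity) (tsum_nonneg fun _ => by positivity)

lemma summable_far : Summable fun k : {k : ℤ // k ∉ nearTranslates} => 1 / (k : ℝ) ^ 2 :=
  (Real.summable_one_div_int_pow.mpr one_lt_two).subtype _

/-- Since |k| ≥ 2 and |Re z| ≤ 1, the point w = z + k has |Re w| ≥ |k|/2 ≥ 1. Thus Im w / |w|² ≤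
1/2, whatever the height of z, and the quadratic bound on the tail gives the summable factor 1/k².
-/
lemma norm_expTail_far_le (n : ℕ) {z : ℂ} (hre : |z.re| ≤ 1) (him : 0 < z.im) {k : ℤ}
    (hk : k ∉ nearTranslates) :
    ‖expTail n (z + k)‖ ≤
      48 * Real.pi ^ 2 * (n ^ 2 * Real.exp (Real.pi * n)) * (1 / (k : ℝ) ^ 2) := by
  have hk2 : (2 : ℝ) ≤ |(k : ℝ)| := by
    exact_mod_cast two_le_abs_of_notMem_nearTranslates hk
  have hpi := Real.pi_pos
  have hre' : |(k : ℝ)| / 2 ≤ |(z + k).re| := by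
    have h := abs_sub_abs_le_abs_sub (k : ℝ) (-z.re)
    rw [abs_neg, sub_neg_eq_add, add_comm (k : ℝ)] at h
    simp only [Complex.add_re, Complex.intCast_re]
    linarith
  have him' : (z + k).im = z.im := by simp
  have hn : |(k : ℝ)| / 2 ≤ ‖z + k‖ := hre'.trans (Complex.abs_re_le_norm _)
  have hsq : ‖z + k‖ ^ 2 = (z + k).re ^ 2 + z.im ^ 2 := by
    rw [← Complex.normSq_eq_norm_sq, Complex.normSq_apply, him']; ring
  have h1 : 1 ≤ (z + k).re ^ 2 := by
    rw [← sq_abs]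
    nlinarith
  have him2 : (z + k).im / ‖z + k‖ ^ 2 ≤ 1 / 2 := by
    rw [him', hsq, div_le_iff₀ (by positivity)]
    nlinarith [sq_nonneg (z.im - 1)]
  refine (norm_expTail_le n (by rwa [him'])).trans ?_
  have hk0 : (0 : ℝ) < |(k : ℝ)| := by linarith
  calc 3 * (2 * Real.pi * n / ‖z + k‖) ^ 2 *
        Real.exp (2 * Real.pi * n * ((z + k).im / ‖z + k‖ ^ 2))
      ≤ 3 * (2 * Real.pi * n / (|(k : ℝ)| / 2)) ^ 2 * Real.exp (2 * Real.pi * n * (1 / 2)) := by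
        gcongr
    _ = _ := by
        rw [show 2 * Real.pi * n * (1 / 2) = Real.pi * n by ring, div_pow, div_pow, sq_abs]
        field_simp
        ring

/-- The sum of `expTail n` over all translates. -/
def expSeries (n : ℕ) (z : ℂ) : ℂ := ∑' k : ℤ, expTail n (z + k)

/-- The sum of `expTail n` over the far translates. -/
def farSeries (n : ℕ) (z : ℂ) : ℂ :=
  ∑' k : {k : ℤ // k ∉ nearTranslates}, expTail n (z + (k : ℤ))

lemma norm_farSeries_le (n : ℕ) {z : ℂ} (hre : |z.re| ≤ 1) (him : 0 < z.im) :
    ‖farSeries n z‖ ≤ farConst * (n ^ 2 * Real.exp (Real.pi * n)) := by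
  refine (tsum_of_norm_bounded ((summable_far.mul_left
    (48 * Real.pi ^ 2 * (n ^ 2 * Real.exp (Real.pi * n)))).hasSum)
    fun k => norm_expTail_far_le n hre him k.2).trans (le_of_eq ?_)
  rw [tsum_mul_left, farConst]
  ring

lemma expSeries_eq (n : ℕ) {z : ℂ} (hre : |z.re| ≤ 1) (him : 0 < z.im) :
    expSeries n z =
      expTail n (z - 1) + (expTail n z + expTail n (z + 1)) + farSeries n z := by
  have hs : Summable fun k : {k : ℤ // k ∉ nearTranslates} => expTail n (z + (k : ℤ)) :=
    Summable.of_norm_bounded (summable_far.mul_left _)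
      fun k => norm_expTail_far_le n hre him k.2
  have hs' : Summable fun k : ℤ => expTail n (z + k) := nearTranslates.summable_compl_iff.mp hs
  rw [expSeries, ← hs'.sum_add_tsum_compl (s := nearTranslates)]
  congr 1
  rw [nearTranslates, Finset.sum_insert (by decide), Finset.sum_insert (by decide),
    Finset.sum_singleton]
  simp [sub_eq_add_neg]

lemma periodic_expSeries (n : ℕ) : Function.Periodic (expSeries n) 1 := by
  intro z
  rw [expSeries, expSeries, ← (Equiv.addRight (1 : ℤ)).tsum_eq fun k : ℤ => expTail n (z + k)]
  refine tsum_congr fun k => ?_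
  rw [Equiv.coe_addRight, Int.cast_add, Int.cast_one, add_right_comm, add_assoc]

lemma abs_re_sub_round_le (z : ℂ) : |(z - (round z.re : ℤ)).re| ≤ 1 / 2 := by
  simpa using abs_sub_round z.re

lemma expSeries_sub_int (n : ℕ) (z : ℂ) (m : ℤ) : expSeries n (z - m) = expSeries n z := by
  simpa using (periodic_expSeries n).sub_int_mul_eq m (x := z)

/-- The far terms are dominated uniformly on the strip |Re z| < 1; any other point is moved into it
by an integer translation. -/
lemma differentiableAt_expSeries (n : ℕ) {z : ℂ} (hz : 0 < z.im) :
    DifferentiableAt ℂ (expSeries n) z := by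
  set U : Set ℂ := {z | z.re < 1} ∩ {z | -1 < z.re} ∩ {z | 0 < z.im} with hU
  have hUo : IsOpen U := ((isOpen_lt Complex.continuous_re continuous_const).inter
    (isOpen_lt continuous_const Complex.continuous_re)).inter
    (isOpen_lt continuous_const Complex.continuous_im)
  have hfar : DifferentiableOn ℂ (farSeries n) U := by
    refine Complex.differentiableOn_tsum_of_summable_norm (summable_far.mul_left _)
      (fun k w hw => ?_) hUo fun k w hw =>
        norm_expTail_far_le n (abs_le.mpr ⟨hw.1.2.le, hw.1.1.le⟩) hw.2 k.2
    have hw0 : w + ((k : ℤ) : ℂ) ≠ 0 := ne_zero_of_im_pos (by simpa using hw.2)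
    exact ((differentiableAt_expTail n hw0).comp w
      (differentiableAt_id.add_const _)).differentiableWithinAt
  have hmain : ∀ w ∈ U, DifferentiableAt ℂ (expSeries n) w := by
    intro w hw
    have hev : expSeries n =ᶠ[𝓝 w] fun z =>
        expTail n (z - 1) + (expTail n z + expTail n (z + 1)) + farSeries n z := by
      filter_upwards [hUo.mem_nhds hw] with z hz
      exact expSeries_eq n (abs_le.mpr ⟨hz.1.2.le, hz.1.1.le⟩) hz.2
    refine DifferentiableAt.congr_of_eventuallyEq ?_ hev
    have h1 : w - 1 ≠ 0 := ne_zero_of_im_pos (by simpa using hw.2)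
    have h2 : w ≠ 0 := ne_zero_of_im_pos hw.2
    have h3 : w + 1 ≠ 0 := ne_zero_of_im_pos (by simpa using hw.2)
    exact (((differentiableAt_expTail n h1).comp w (differentiableAt_id.sub_const _)).add
      ((differentiableAt_expTail n h2).add
        ((differentiableAt_expTail n h3).comp w (differentiableAt_id.add_const _)))).add
      (hfar.differentiableAt (hUo.mem_nhds hw))
  have hr := abs_le.mp (abs_re_sub_round_le z)
  have hm : z - (round z.re : ℤ) ∈ U :=
    ⟨⟨show (z - (round z.re : ℤ)).re < 1 by linarith,
      show -1 < (z - (round z.re : ℤ)).re by linarith⟩,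
      show 0 < (z - (round z.re : ℤ)).im by simpa using hz⟩
  have := (hmain _ hm).comp z (differentiableAt_id.sub_const ((round z.re : ℤ) : ℂ))
  refine this.congr_of_eventuallyEq (Eventually.of_forall fun w => ?_)
  simp [expSeries_sub_int]

lemma tendsto_expSeries (n : ℕ) : Tendsto (expSeries n) (comap Complex.im atTop) (𝓝 0) := by
  -- The dominating series is available only for |Re z| ≤ 1, so the limit is first taken inside this
  -- strip and then transported by periodicity.
  set l : Filter ℂ := comap Complex.im atTop ⊓ 𝓟 {z | |z.re| ≤ 1} with hl
  have hpos : ∀ᶠ z : ℂ in comap Complex.im atTop, 0 < z.im :=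
    preimage_mem_comap (Ioi_mem_atTop 0)
  have hstrip : ∀ᶠ z : ℂ in l, |z.re| ≤ 1 ∧ 0 < z.im :=
    (eventually_inf_principal.mpr (Eventually.of_forall fun z hz => hz)).and
      (hpos.filter_mono inf_le_left)
  have hk : ∀ k : ℤ, Tendsto (fun z : ℂ => expTail n (z + k)) l (𝓝 0) := fun k =>
    (tendsto_expTail n k).mono_left inf_le_left
  have hfar : Tendsto (farSeries n) l (𝓝 0) := by
    have := tendsto_tsum_of_dominated_convergence (𝓕 := l)
      (f := fun (z : ℂ) (k : {k : ℤ // k ∉ nearTranslates}) => expTail n (z + (k : ℤ)))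
      (g := fun _ => (0 : ℂ))
      (summable_far.mul_left (48 * Real.pi ^ 2 * (n ^ 2 * Real.exp (Real.pi * n))))
      (fun k => hk k) (hstrip.mono fun z hz k => norm_expTail_far_le n hz.1 hz.2 k.2)
    rw [tsum_zero] at this
    exact this
  have hlim : Tendsto (expSeries n) l (𝓝 0) := by
    have h1 := ((hk (-1)).add ((hk 0).add (hk 1))).add hfar
    simp only [add_zero] at h1
    refine h1.congr' (hstrip.mono fun z hz => ?_)
    rw [expSeries_eq n hz.1 hz.2]
    simp [sub_eq_add_neg]
  have hround : Tendsto (fun z : ℂ => z - (round z.re : ℤ)) (comap Complex.im atTop) l := by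
    refine tendsto_inf.mpr ⟨tendsto_comap_iff.mpr ?_, tendsto_principal.mpr ?_⟩
    · refine tendsto_comap.congr fun z => ?_
      simp
    · exact Eventually.of_forall fun z => (abs_re_sub_round_le z).trans (by norm_num)
  refine (hlim.comp hround).congr fun z => ?_
  simp [expSeries_sub_int]

/-! ### The coefficients as functions of the inverse image under `j` -/

lemma qParam_one (z : ℂ) : qParam 1 z = Complex.exp (2 * Real.pi * Complex.I * z) := by
  simp [qParam]

lemma j_ofComplex {z : ℂ} (hz : 0 < z.im) : j (ofComplex z) = qj (qParam 1 z) / qParam 1 z := by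
  rw [ofComplex_apply_of_im_pos hz, j_eq_qj]

lemma differentiableAt_a_j (n : ℕ) {z : ℂ} (hz : 0 < z.im) :
    DifferentiableAt ℂ (fun z => a (j (ofComplex z)) n) z := by
  have hev : (fun z => j (ofComplex z)) =ᶠ[𝓝 z] fun z => qj (qParam 1 z) / qParam 1 z := by
    filter_upwards [isOpen_upperHalfPlaneSet.mem_nhds hz] with w hw using j_ofComplex hw
  have hq : DifferentiableAt ℂ (fun z => qParam 1 z) z := differentiable_qParam z
  have hj : DifferentiableAt ℂ (fun z => j (ofComplex z)) z :=
    DifferentiableAt.congr_of_eventuallyEq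
      (((differentiableAt_qj (norm_qParam_lt_one one_pos hz)).comp z hq).div hq
        (qParam_ne_zero' z)) hev
  exact (differentiable_a n _).comp z hj

lemma periodic_a_j (n : ℕ) : Function.Periodic (fun z => a (j (ofComplex z)) n) 1 := by
  intro z
  have hi : (z + 1).im = z.im := by simp
  rcases le_or_gt z.im 0 with h | h
  · simp only [ofComplex_apply_of_im_nonpos h, ofComplex_apply_of_im_nonpos (hi.trans_le h)]
  · have hq : qParam 1 (z + 1) = qParam 1 z := by
      rw [qParam_one, qParam_one, Complex.exp_eq_exp_iff_exists_int]
      exact ⟨1, by push_cast; ring⟩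
    simp only [j_ofComplex h, j_ofComplex (hi ▸ h : 0 < (z + 1).im), hq]

lemma a_j_inversion (n : ℕ) {z : ℂ} (hz : 0 < z.im) :
    a (j (ofComplex (-1 / z))) n = a (j (ofComplex z)) n := by
  rw [ofComplex_apply_of_im_pos hz, ← j_S_smul ⟨z, hz⟩]
  congr 2
  have : -1 / z = ((ModularGroup.S • (⟨z, hz⟩ : ℍ) : ℍ) : ℂ) := by
    rw [modular_S_smul, coe_mk, inv_neg, neg_div, one_div, coe_mk]
  rw [this, ofComplex_apply]

lemma tendsto_a_j_sub (n : ℕ) :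
    Tendsto (fun z => a (j (ofComplex z)) n - Complex.exp (-(2 * Real.pi * Complex.I * n * z)))
      (comap Complex.im atTop) (𝓝 0) := by
  obtain ⟨r, C, hr0, hr1, hC⟩ := norm_a_sub_le n
  have hq : Tendsto (fun z => qParam 1 z) (comap Complex.im atTop) (𝓝 0) :=
    (Function.Periodic.qParam_tendsto one_pos).mono_right nhdsWithin_le_nhds
  have hqn : Tendsto (fun z => C * ‖qParam 1 z‖) (comap Complex.im atTop) (𝓝 0) := by
    simpa using hq.norm.const_mul C
  refine squeeze_zero_norm' ?_ hqn
  have hev : ∀ᶠ z in comap Complex.im atTop, ‖qParam 1 z‖ ≤ r := by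
    filter_upwards [hq.eventually (Metric.closedBall_mem_nhds (0 : ℂ) hr0)] with z hz
    simpa using hz
  filter_upwards [hev, preimage_mem_comap (Ioi_mem_atTop 0)] with z hz him
  rw [j_ofComplex him]
  have h := hC _ (qParam_ne_zero' z) hz
  have he : (qParam 1 z ^ n)⁻¹ = Complex.exp (-(2 * Real.pi * Complex.I * n * z)) := by
    rw [qParam_one, ← Complex.exp_nat_mul, ← Complex.exp_neg]
    ring_nf
  rwa [he] at h

lemma periodic_exp_neg (n : ℕ) :
    Function.Periodic (fun z : ℂ => Complex.exp (-(2 * Real.pi * Complex.I * n * z))) 1 := by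
  intro z
  simp only
  rw [Complex.exp_eq_exp_iff_exists_int]
  exact ⟨-n, by push_cast; ring⟩

/-- The modular function `z ↦ a (j z) n` without its exponentially large part near the cusp and
its images under the inversion. -/
def remainder (n : ℕ) (z : ℂ) : ℂ :=
  a (j (ofComplex z)) n - Complex.exp (-(2 * Real.pi * Complex.I * n * z)) - expSeries n z

lemma norm_linear_term_le (n : ℕ) {w : ℂ} (hw : 1 / 2 ≤ w.im) :
    ‖2 * Real.pi * Complex.I * n / w‖ ≤ 4 * Real.pi * n := by
  have hn : 1 / 2 ≤ ‖w‖ := (hw.trans (le_abs_self _)).trans (Complex.abs_im_le_norm w)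
  have := Real.pi_pos
  rw [norm_two_pi_I_div, div_le_iff₀ (by linarith)]
  nlinarith [mul_nonneg this.le (Nat.cast_nonneg (α := ℝ) n)]

lemma le_sq_mul_exp {n : ℕ} (hn : 1 ≤ n) :
    1 ≤ n ^ 2 * Real.exp (Real.pi * n) ∧ (n : ℝ) ≤ n ^ 2 * Real.exp (Real.pi * n) := by
  have h1 : (1 : ℝ) ≤ n := by exact_mod_cast hn
  have h2 : 1 ≤ Real.exp (Real.pi * n) := Real.one_le_exp (by have := Real.pi_pos; positivity)
  constructor <;> nlinarith [mul_nonneg (sub_nonneg.mpr h1) (sub_nonneg.mpr h2)]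

lemma exp_add_int {n : ℕ} {u v : ℂ} (m : ℤ)
    (h : u = v + m) : Complex.exp (2 * Real.pi * Complex.I * n * u) =
      Complex.exp (2 * Real.pi * Complex.I * n * v) := by
  rw [Complex.exp_eq_exp_iff_exists_int]
  exact ⟨n * m, by rw [h]; push_cast; ring⟩

/-- Inversion permutes the four large exponentials: e(-nz) is exchanged with e(n/z), and the terms
at z ± 1 correspond to those at w ∓ 1. They cancel, as do the constants and the modular term. What
is left is six linear terms of size at most 4πn, whence 24π, and two far sums. -/
lemma norm_remainder_sub_inversion_le {n : ℕ} (hn : 1 ≤ n) {z : ℂ} (him : z.im = 1 / 2)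
    (hre : |z.re| ≤ 1 / 2) : ‖remainder n z - remainder n (-1 / z)‖ ≤
      (24 * Real.pi + 2 * farConst) * (n ^ 2 * Real.exp (Real.pi * n)) := by
  have hz0 : 0 < z.im := by rw [him]; norm_num
  have hzne : z ≠ 0 := ne_zero_of_im_pos hz0
  set w := -1 / z with hw
  have hns : Complex.normSq z = z.re ^ 2 + 1 / 4 := by
    rw [Complex.normSq_apply, him]; ring
  have hns0 : 0 < Complex.normSq z := by rw [hns]; positivity
  have hre2 := abs_le.mp hre
  have hwim : 1 ≤ w.im := by
    rw [hw, neg_div, one_div, Complex.neg_im, Complex.inv_im, him, neg_div, neg_neg,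
      le_div_iff₀ hns0, hns]
    nlinarith
  have hwre : |w.re| ≤ 1 := by
    rw [hw, neg_div, one_div, Complex.neg_re, Complex.inv_re, abs_neg, abs_div,
      abs_of_pos hns0, div_le_iff₀ hns0, hns, ← sq_abs]
    nlinarith [sq_nonneg (|z.re| - 1 / 2)]
  have hz1 : z - 1 ≠ 0 := ne_zero_of_im_pos (by simpa using hz0)
  have hz2 : z + 1 ≠ 0 := ne_zero_of_im_pos (by simpa using hz0)
  have e1 : Complex.exp (-(2 * Real.pi * Complex.I * n * w)) =
      Complex.exp (2 * Real.pi * Complex.I * n / z) := by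
    congr 1
    rw [hw]
    field_simp
  have e2 : Complex.exp (2 * Real.pi * Complex.I * n / w) =
      Complex.exp (-(2 * Real.pi * Complex.I * n * z)) := by
    congr 1
    rw [hw]
    field_simp
  have hw1 : w - 1 ≠ 0 := ne_zero_of_im_pos (by simp; linarith)
  have hw2 : w + 1 ≠ 0 := ne_zero_of_im_pos (by simp; linarith)
  have hwz : w * z = -1 := by rw [hw]; field_simp
  -- With w = -1/z one has 1/(w - 1) = 1/(z + 1) - 1, and the integer shift does not affect the
  -- exponential; the next identity is similar.
  have e3 : Complex.exp (2 * Real.pi * Complex.I * n / (w - 1)) =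
      Complex.exp (2 * Real.pi * Complex.I * n / (z + 1)) := by
    rw [div_eq_mul_inv, div_eq_mul_inv]
    refine exp_add_int (-1) ?_
    field_simp
    push_cast
    linear_combination hwz
  have e4 : Complex.exp (2 * Real.pi * Complex.I * n / (w + 1)) =
      Complex.exp (2 * Real.pi * Complex.I * n / (z - 1)) := by
    rw [div_eq_mul_inv, div_eq_mul_inv]
    refine exp_add_int 1 ?_
    field_simp
    push_cast
    linear_combination -hwz
  have key : remainder n z - remainder n w =
      2 * Real.pi * Complex.I * n / (z - 1) + 2 * Real.pi * Complex.I * n / z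
        + 2 * Real.pi * Complex.I * n / (z + 1) - 2 * Real.pi * Complex.I * n / (w - 1)
        - 2 * Real.pi * Complex.I * n / w - 2 * Real.pi * Complex.I * n / (w + 1)
        - farSeries n z + farSeries n w := by
    rw [remainder, remainder, a_j_inversion n hz0, expSeries_eq n (hre.trans (by norm_num)) hz0,
      expSeries_eq n hwre (by linarith), e1]
    simp only [expTail, e2, e3, e4]
    ring
  have b1 := norm_linear_term_le n (w := z - 1) (by simp [him])
  have b2 := norm_linear_term_le n (w := z) (by simp [him])
  have b3 := norm_linear_term_le n (w := z + 1) (by simp [him])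
  have b4 := norm_linear_term_le n (w := w - 1) (by simp; linarith)
  have b5 := norm_linear_term_le n (w := w) (by linarith)
  have b6 := norm_linear_term_le n (w := w + 1) (by simp; linarith)
  have b7 := norm_farSeries_le n (hre.trans (by norm_num : (1 / 2 : ℝ) ≤ 1)) hz0
  have b8 := norm_farSeries_le n hwre (by linarith)
  have hN := (le_sq_mul_exp hn).2
  have hpi := Real.pi_pos
  rw [key]
  refine (norm_add_le _ _).trans ?_
  refine (add_le_add_left ((norm_sub_le _ _).trans (add_le_add_left ((norm_sub_le _ _).trans
    (add_le_add_left ((norm_sub_le _ _).trans (add_le_add_left ((norm_sub_le _ _).trans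
    (add_le_add_left ((norm_add_le _ _).trans (add_le_add_left (norm_add_le _ _) _)) _)) _))
    _)) _)) _).trans ?_
  have := mul_le_mul_of_nonneg_left hN hpi.le
  nlinarith

/-- The coefficients at `j(z)` are, up to a small error, the sum of the exponentials
`exp(-2πin z')` over `z' = z, -1/z, -1/(z ± 1)`. -/
theorem norm_a_j_sub_le : ∃ C : ℝ, 0 ≤ C ∧ ∀ n : ℕ, 1 ≤ n → ∀ z : ℍ, 1 / 2 ≤ z.im →
    |z.re| ≤ 1 / 2 →
    ‖a (j z) n - (Complex.exp (-(2 * Real.pi * Complex.I * n * z))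
      + Complex.exp (2 * Real.pi * Complex.I * n / z)
      + Complex.exp (2 * Real.pi * Complex.I * n / (z + 1))
      + Complex.exp (2 * Real.pi * Complex.I * n / (z - 1)))‖
      ≤ C * (n ^ 2 * Real.exp (Real.pi * n)) := by
  have hpi := Real.pi_pos
  -- Twice the inversion error contributes 48π + 4 `farConst`; restoring three linear terms, three
  -- constants and the far sum adds 12π + 3 + `farConst`.
  refine ⟨60 * Real.pi + 3 + 5 * farConst, by have := farConst_nonneg; positivity,
    fun n hn z him hre => ?_⟩
  have hR := norm_le_of_norm_sub_inversion_le (R := remainder n)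
    (fun z hz => ((differentiableAt_a_j n hz).sub (by fun_prop)).sub (differentiableAt_expSeries n hz))
    (((periodic_a_j n).sub (periodic_exp_neg n)).sub (periodic_expSeries n))
    (by simpa only [sub_zero] using! (tendsto_a_j_sub n).sub (tendsto_expSeries n))
    (fun z h1 h2 => norm_remainder_sub_inversion_le hn h1 h2) (z := z) him
  have b1 := norm_linear_term_le n (w := (z : ℂ) - 1) (by simpa using him)
  have b2 := norm_linear_term_le n (w := z) (by simpa using him)
  have b3 := norm_linear_term_le n (w := (z : ℂ) + 1) (by simpa using him)
  have hre1 : |(z : ℂ).re| ≤ 1 := by simpa using hre.trans (by norm_num)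
  have b7 := norm_farSeries_le n hre1 z.im_pos
  have key : a (j z) n - (Complex.exp (-(2 * Real.pi * Complex.I * n * z))
      + Complex.exp (2 * Real.pi * Complex.I * n / z)
      + Complex.exp (2 * Real.pi * Complex.I * n / (z + 1))
      + Complex.exp (2 * Real.pi * Complex.I * n / (z - 1))) =
      remainder n z + farSeries n z - 3 - 2 * Real.pi * Complex.I * n / (z - 1)
        - 2 * Real.pi * Complex.I * n / z - 2 * Real.pi * Complex.I * n / (z + 1) := by
    rw [remainder, ofComplex_apply, expSeries_eq n hre1 z.im_pos]
    simp only [expTail]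
    ring
  obtain ⟨h1, h2⟩ := le_sq_mul_exp hn
  rw [key]
  refine (norm_sub_le _ _).trans ?_
  refine (add_le_add_left ((norm_sub_le _ _).trans (add_le_add_left ((norm_sub_le _ _).trans
    (add_le_add_left ((norm_sub_le _ _).trans (add_le_add_left (norm_add_le _ _) _)) _)) _))
    _).trans ?_
  have h3 : ‖(3 : ℂ)‖ = 3 := by simp
  have := mul_le_mul_of_nonneg_left h2 hpi.le
  rw [h3]
  nlinarith

/-! ### Exponentially small sequences -/

/-- A sequence that decays exponentially. -/
def ExpSmall (f : ℕ → ℂ) : Prop :=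
  ∃ κ : ℝ, 0 < κ ∧ f =O[atTop] fun n : ℕ => Real.exp (-(κ * n))

lemma isBigO_exp_neg {κ κ' : ℝ} (h : κ ≤ κ') :
    (fun n : ℕ => Real.exp (-(κ' * n))) =O[atTop] fun n : ℕ => Real.exp (-(κ * n)) := by
  refine .of_norm_le fun n => ?_
  rw [Real.norm_of_nonneg (Real.exp_pos _).le]
  have : (0 : ℝ) ≤ n := n.cast_nonneg
  exact Real.exp_le_exp.mpr (by nlinarith)

lemma ExpSmall.add {f g : ℕ → ℂ} (hf : ExpSmall f) (hg : ExpSmall g) :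
    ExpSmall fun n => f n + g n := by
  obtain ⟨κ, h0, h⟩ := hf
  obtain ⟨κ', h0', h'⟩ := hg
  exact ⟨min κ κ', lt_min h0 h0', (h.trans (isBigO_exp_neg (min_le_left _ _))).add
    (h'.trans (isBigO_exp_neg (min_le_right _ _)))⟩

lemma ExpSmall.neg {f : ℕ → ℂ} (hf : ExpSmall f) : ExpSmall fun n => -f n := by
  obtain ⟨κ, h0, h⟩ := hf
  exact ⟨κ, h0, h.neg_left⟩

lemma ExpSmall.tendsto {f : ℕ → ℂ} (hf : ExpSmall f) : Tendsto f atTop (𝓝 0) := by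
  obtain ⟨κ, h0, h⟩ := hf
  refine h.trans_tendsto (Real.tendsto_exp_atBot.comp (tendsto_neg_atTop_atBot.comp ?_))
  exact tendsto_natCast_atTop_atTop.const_mul_atTop h0

/-- The exponential `exp(2πin / w)` on the scale `exp(2πny)`. -/
def scaledExp (y : ℝ) (w : ℂ) (n : ℕ) : ℂ :=
  Complex.exp (2 * Real.pi * Complex.I * n / w) * (Real.exp (-(2 * Real.pi * n * y)) : ℝ)

/-- The growth rate of e(n/w) is governed by Im(-1/w) = Im w / |w|², which is below Im w outside the
unit disc. -/
lemma expSmall_scaledExp {w : ℂ} (him : 0 < w.im) (hn : 1 < ‖w‖) :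
    ExpSmall (scaledExp w.im w) := by
  have hpi := Real.pi_pos
  have h1 : w.im / ‖w‖ ^ 2 < w.im := by
    rw [div_lt_iff₀ (by positivity)]
    exact lt_mul_of_one_lt_right him (one_lt_pow₀ hn two_ne_zero)
  refine ⟨2 * Real.pi * (w.im - w.im / ‖w‖ ^ 2), by
    have := sub_pos.mpr h1
    positivity, .of_norm_le fun n => ?_⟩
  rw [scaledExp, norm_mul, Complex.norm_exp, re_two_pi_I_div, Complex.norm_real,
    Real.norm_of_nonneg (Real.exp_pos _).le, ← Real.exp_add]
  apply Real.exp_le_exp.mpr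
  linarith

/-- On the unit circle 1/w is the conjugate of w, so the scaling removes the modulus exactly and
leaves a phase. -/
lemma scaledExp_eq {w : ℂ} (hn : ‖w‖ = 1) (n : ℕ) :
    scaledExp w.im w n = Complex.exp (2 * Real.pi * Complex.I * n * w.re) := by
  rw [scaledExp, Complex.ofReal_exp, ← Complex.exp_add]
  congr 1
  have h : w⁻¹ = w.re - w.im * Complex.I := by
    rw [Complex.inv_def, Complex.normSq_eq_norm_sq, hn]
    simp [Complex.ext_iff]
  rw [div_eq_mul_inv, h]
  push_cast
  linear_combination (-2 * Real.pi * n * w.im) * Complex.I_sq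

/-! ### The coefficients at points of the fundamental domain -/

/-- The coefficients on the scale `exp(2πny)`. -/
def scaledCoeff (z : ℍ) (n : ℕ) : ℂ := a (j z) n * (Real.exp (-(2 * Real.pi * n * z.im)) : ℝ)

lemma norm_scaledCoeff (z : ℍ) (n : ℕ) :
    ‖scaledCoeff z n‖ = ‖a (j z) n‖ * Real.exp (-(2 * Real.pi * n * z.im)) := by
  rw [scaledCoeff, norm_mul, Complex.norm_real, Real.norm_of_nonneg (Real.exp_pos _).le]

lemma sq_re_add_sq_im (z : ℍ) : ‖(z : ℂ)‖ ^ 2 = z.re ^ 2 + z.im ^ 2 := by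
  rw [← Complex.normSq_eq_norm_sq, Complex.normSq_apply]
  simp [sq]

lemma sq_norm_add_one (z : ℍ) : ‖(z : ℂ) + 1‖ ^ 2 = ‖(z : ℂ)‖ ^ 2 + 2 * z.re + 1 := by
  rw [sq_re_add_sq_im, ← Complex.normSq_eq_norm_sq, Complex.normSq_apply]
  simp
  ring

lemma sq_norm_sub_one (z : ℍ) : ‖(z : ℂ) - 1‖ ^ 2 = ‖(z : ℂ)‖ ^ 2 - 2 * z.re + 1 := by
  rw [sq_re_add_sq_im, ← Complex.normSq_eq_norm_sq, Complex.normSq_apply]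
  simp
  ring

lemma three_quarters_le_sq_im {z : ℍ} (hz : z ∈ fundamentalDomain) : 3 / 4 ≤ z.im ^ 2 := by
  obtain ⟨h1, h2, h3, -⟩ := hz
  have := sq_re_add_sq_im z
  nlinarith

lemma half_lt_im {z : ℍ} (hz : z ∈ fundamentalDomain) : 1 / 2 < z.im := by
  have h1 := three_quarters_le_sq_im hz
  have h2 := z.im_pos
  by_contra! h
  nlinarith

/-- After scaling, the error is n² exp(-2κn) with κ = π(y - 1/2) > 0; half of the exponent absorbs
n². -/
lemma expSmall_remainder {z : ℍ} (hz : z ∈ fundamentalDomain) : ExpSmall fun n => scaledCoeff z n -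
    (Complex.exp (-(2 * Real.pi * Complex.I * n * z.re)) + scaledExp z.im z n
      + scaledExp z.im (z + 1) n + scaledExp z.im (z - 1) n) := by
  obtain ⟨C, hC0, hC⟩ := norm_a_j_sub_le
  have him := half_lt_im hz
  have hpi := Real.pi_pos
  set κ := Real.pi * (z.im - 1 / 2) with hκ
  have hκ0 : 0 < κ := mul_pos hpi (by linarith)
  refine ⟨κ, hκ0, ?_⟩
  have hpow : (fun n : ℕ => (n : ℝ) ^ 2) =O[atTop] fun n : ℕ => Real.exp (κ * n) :=
    ((isLittleO_pow_exp_pos_mul_atTop 2 hκ0).comp_tendsto tendsto_natCast_atTop_atTop).isBigO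
  have hmul : (fun n : ℕ => C * ((n : ℝ) ^ 2 * Real.exp (-(2 * κ * n)))) =O[atTop]
      fun n : ℕ => Real.exp (-(κ * n)) := by
    refine ((hpow.mul (Asymptotics.isBigO_refl
      (fun n : ℕ => Real.exp (-(2 * κ * n))) atTop)).const_mul_left C).congr_right fun n => ?_
    rw [← Real.exp_add]
    ring_nf
  refine Asymptotics.IsBigO.trans (.of_bound 1 ?_) hmul
  filter_upwards [eventually_ge_atTop 1] with n hn
  have h := hC n hn z him.le (abs_le.mpr ⟨hz.2.1, hz.2.2.1.le⟩)
  set e : ℂ := ((Real.exp (-(2 * Real.pi * n * z.im)) : ℝ) : ℂ) with he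
  have hexp : Complex.exp (-(2 * Real.pi * Complex.I * n * z)) * e =
      Complex.exp (-(2 * Real.pi * Complex.I * n * z.re)) := by
    rw [he, Complex.ofReal_exp, ← Complex.exp_add]
    congr 1
    have : (z : ℂ) = z.re + z.im * Complex.I := (Complex.re_add_im _).symm
    rw [this]
    push_cast
    linear_combination (-2 * Real.pi * n * z.im) * Complex.I_sq
  have heq : scaledCoeff z n -
    (Complex.exp (-(2 * Real.pi * Complex.I * n * z.re)) + scaledExp z.im z n
      + scaledExp z.im (z + 1) n + scaledExp z.im (z - 1) n) =
      (a (j z) n - (Complex.exp (-(2 * Real.pi * Complex.I * n * z))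
      + Complex.exp (2 * Real.pi * Complex.I * n / z)
      + Complex.exp (2 * Real.pi * Complex.I * n / (z + 1))
      + Complex.exp (2 * Real.pi * Complex.I * n / (z - 1)))) * e := by
    rw [← hexp, scaledCoeff]
    simp only [scaledExp, ← he]
    ring
  have hen : ‖e‖ = Real.exp (-(2 * Real.pi * n * z.im)) := by
    rw [he, Complex.norm_real, Real.norm_of_nonneg (Real.exp_pos _).le]
  have hexp2 : Real.exp (Real.pi * n) * Real.exp (-(2 * Real.pi * n * z.im)) =
      Real.exp (-(2 * κ * n)) := by
    rw [← Real.exp_add, hκ]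
    ring_nf
  rw [heq, norm_mul, hen, one_mul, ← hexp2, Real.norm_of_nonneg (by positivity)]
  calc _ ≤ C * (n ^ 2 * Real.exp (Real.pi * n)) * Real.exp (-(2 * Real.pi * n * z.im)) := by
        gcongr
    _ = _ := by ring

lemma expSmall_sub_one {z : ℍ}
    (hz : z ∈ fundamentalDomain) : ExpSmall (scaledExp z.im (z - 1)) := by
  have h := expSmall_scaledExp (w := (z : ℂ) - 1) (by simpa using z.im_pos) (by
    have h1 := sq_norm_sub_one z
    obtain ⟨h2, -, h3, -⟩ := hz
    by_contra! h4
    nlinarith [norm_nonneg ((z : ℂ) - 1)])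
  simpa using h

/-- Here |z + 1|² = |z|² + 2x + 1, which exceeds 1 on the domain except at the corner of order
three. That corner is where the third main term appears. -/
lemma expSmall_add_one {z : ℍ} (hz : z ∈ fundamentalDomain) (h : 1 < ‖(z : ℂ)‖ ∨ -(1 / 2) < z.re) :
    ExpSmall (scaledExp z.im (z + 1)) := by
  have h := expSmall_scaledExp (w := (z : ℂ) + 1) (by simpa using z.im_pos) (by
    have h1 := sq_norm_add_one z
    obtain ⟨h2, h3, -, -⟩ := hz
    by_contra! h4
    rcases h with h | h <;> nlinarith [norm_nonneg ((z : ℂ) + 1)])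
  simpa using h

/-- The asymptotics of the coefficients in the case `|z| > 1`. -/
theorem expSmall_of_one_lt_norm {z : ℍ}
    (hz : z ∈ fundamentalDomain) (h : 1 < ‖(z : ℂ)‖) : ExpSmall fun n =>
    scaledCoeff z n - Complex.exp (-(2 * Real.pi * Complex.I * n * z.re)) := by
  have h1 : ExpSmall (scaledExp z.im z) := expSmall_scaledExp (w := z) z.im_pos h
  have := (((expSmall_remainder hz).add h1).add (expSmall_add_one hz (.inl h))).add
    (expSmall_sub_one hz)
  refine (congrArg ExpSmall (funext fun n => ?_)).mp this
  ring

/-- The asymptotics of the coefficients on the open arc. -/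
theorem expSmall_of_norm_eq_one {z : ℍ}
    (hz : z ∈ fundamentalDomain) (h : ‖(z : ℂ)‖ = 1) (hre : -(1 / 2) < z.re) :
    ExpSmall fun n => scaledCoeff z n - ((2 * Real.cos (2 * Real.pi * n * z.re) : ℝ) : ℂ) := by
  have := ((expSmall_remainder hz).add (expSmall_add_one hz (.inr hre))).add
    (expSmall_sub_one hz)
  refine (congrArg ExpSmall (funext fun n => ?_)).mp this
  have h1 : scaledExp z.im z n = Complex.exp (2 * Real.pi * Complex.I * n * z.re) :=
    scaledExp_eq h n
  rw [h1]
  push_cast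
  rw [Complex.two_cos, show (2 * Real.pi * n * z.re : ℂ) * Complex.I
    = 2 * Real.pi * Complex.I * n * z.re by ring, show -(2 * Real.pi * n * z.re : ℂ) * Complex.I
    = -(2 * Real.pi * Complex.I * n * z.re) by ring]
  ring

/-- The asymptotics of the coefficients at the elliptic point of order three. -/
theorem expSmall_of_re_eq {z : ℍ}
    (hz : z ∈ fundamentalDomain) (h : ‖(z : ℂ)‖ = 1) (hre : z.re = -(1 / 2)) :
    ExpSmall fun n => scaledCoeff z n - 3 * (-1) ^ n := by
  have := (expSmall_remainder hz).add (expSmall_sub_one hz)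
  refine (congrArg ExpSmall (funext fun n => ?_)).mp this
  have h1 : scaledExp z.im z n = Complex.exp (2 * Real.pi * Complex.I * n * z.re) :=
    scaledExp_eq h n
  have hn1 : ‖(z : ℂ) + 1‖ = 1 := by
    have := sq_norm_add_one z
    rw [h, hre] at this
    nlinarith [norm_nonneg ((z : ℂ) + 1)]
  have h2 : scaledExp z.im (z + 1) n = Complex.exp (2 * Real.pi * Complex.I * n * (z.re + 1)) := by
    simpa using scaledExp_eq hn1 n
  have e0 : Complex.exp (Real.pi * Complex.I * n) = (-1) ^ n := by
    rw [mul_comm _ (n : ℂ), Complex.exp_nat_mul, Complex.exp_pi_mul_I]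
  have e1 : Complex.exp (-(Real.pi * Complex.I * n)) = (-1) ^ n := by
    rw [Complex.exp_neg, e0, ← inv_pow]
    norm_num
  rw [h1, h2, hre]
  push_cast
  rw [show -(2 * Real.pi * Complex.I * n * -(1 / 2) : ℂ) = Real.pi * Complex.I * n by ring,
    show (2 * Real.pi * Complex.I * n * -(1 / 2) : ℂ) = -(Real.pi * Complex.I * n) by ring,
    show (2 * Real.pi * Complex.I * n * (-(1 / 2) + 1) : ℂ) = Real.pi * Complex.I * n by ring,
    e0, e1]
  ring

/-! ### Growth of the coefficients -/

/-- A sequence that does not decay exponentially along any subsequence. -/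
def SubexpLower (f : ℕ → ℂ) : Prop :=
  ∀ δ : ℝ, 0 < δ → ∀ᶠ n : ℕ in atTop, Real.exp (-(δ * n)) ≤ ‖f n‖

lemma eventually_const_mul_exp_le (C : ℝ) {δ δ' : ℝ} (h : δ < δ') :
    ∀ᶠ n : ℕ in atTop, C * Real.exp (-(δ' * n)) ≤ Real.exp (-(δ * n)) := by
  have ht : Tendsto (fun n : ℕ => Real.exp ((δ' - δ) * n)) atTop atTop :=
    Real.tendsto_exp_atTop.comp
      (tendsto_natCast_atTop_atTop.const_mul_atTop (sub_pos.mpr h))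
  filter_upwards [ht.eventually_ge_atTop C] with n hn
  calc C * Real.exp (-(δ' * n)) ≤ Real.exp ((δ' - δ) * n) * Real.exp (-(δ' * n)) := by gcongr
    _ = _ := by rw [← Real.exp_add]; ring_nf

lemma ExpSmall.sub_symm {f g : ℕ → ℂ} (h : ExpSmall fun n => f n - g n) :
    ExpSmall fun n => g n - f n := by
  refine (congrArg ExpSmall (funext fun n => ?_)).mp h.neg
  ring

lemma SubexpLower.of_expSmall_sub {f g : ℕ → ℂ} (hf : SubexpLower f)
    (h : ExpSmall fun n => f n - g n) : SubexpLower g := by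
  intro δ hδ
  obtain ⟨κ, hκ, hO⟩ := h
  obtain ⟨C, hC0, hC⟩ := hO.exists_pos
  -- A rate strictly below both: below κ the difference is eventually at most half of exp(-δ'n), and
  -- below δ the other half still exceeds exp(-δn).
  set δ' := min δ κ / 2 with hδ'
  have hmin : 0 < min δ κ := lt_min hδ hκ
  have h1 : δ' < δ := by linarith [min_le_left δ κ]
  have h2 : δ' < κ := by linarith [min_le_right δ κ]
  filter_upwards [hf δ' (by positivity), hC.bound, eventually_const_mul_exp_le (2 * C) h2,
    eventually_const_mul_exp_le 2 h1] with n ha hb hc hd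
  rw [Real.norm_of_nonneg (Real.exp_pos _).le] at hb
  have := norm_sub_norm_le (f n) (g n)
  linarith

lemma subexpLower_iff {f g : ℕ → ℂ} (h : ExpSmall fun n => f n - g n) :
    SubexpLower f ↔ SubexpLower g :=
  ⟨fun hf => hf.of_expSmall_sub h, fun hg => hg.of_expSmall_sub h.sub_symm⟩

lemma eventually_exp_le (c : ℝ) (hc : 0 < c) {δ : ℝ} (hδ : 0 < δ) :
    ∀ᶠ n : ℕ in atTop, Real.exp (-(δ * n)) ≤ c := by
  filter_upwards [eventually_const_mul_exp_le c⁻¹ hδ] with n hn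
  simpa [inv_mul_le_iff₀ hc] using hn

lemma frequently_of_expSmall_sub {f g : ℕ → ℂ} (h : ExpSmall fun n => f n - g n)
    (hg : ∃ᶠ n in atTop, 1 ≤ ‖g n‖) {δ : ℝ} (hδ : 0 < δ) :
    ∃ᶠ n : ℕ in atTop, Real.exp (-(δ * n)) ≤ ‖f n‖ := by
  have h0 : ∀ᶠ n in atTop, ‖f n - g n‖ < 1 / 2 := by
    have := h.tendsto.norm
    rw [norm_zero] at this
    exact this.eventually_lt_const (by norm_num)
  refine (hg.and_eventually (h0.and (eventually_exp_le (1 / 2) (by norm_num) hδ))).mono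
    fun n hn => ?_
  obtain ⟨h1, h2, h3⟩ := hn
  have := norm_sub_norm_le (g n) (f n)
  rw [norm_sub_rev] at this
  linarith

lemma subexpLower_of_one_le {f : ℕ → ℂ} (hf : ∀ n, 1 ≤ ‖f n‖) : SubexpLower f := fun δ hδ =>
  Eventually.of_forall fun n => (Real.exp_le_one_iff.mpr (by
    rw [neg_nonpos]; positivity)).trans (hf n)

lemma b_le_add {z : ℍ} {n : ℕ} (hn : 1 ≤ n) {δ : ℝ} (hδ : 0 < δ)
    (h : ‖scaledCoeff z n‖ ≤ Real.exp (2 * Real.pi * n * δ)) : b (j z) n ≤ z.im + δ := by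
  have hpi := Real.pi_pos
  have hy := z.im_pos
  have hn0 : (0 : ℝ) < n := by exact_mod_cast hn
  have hd : 0 < 2 * Real.pi * n := by positivity
  rw [b, div_le_iff₀ hd]
  rcases eq_or_ne (a (j z) n) 0 with h0 | h0
  -- A vanishing coefficient has b(n) = 0 by the convention log 0 = 0, which is harmless in an upper
  -- bound as y > 0.
  · rw [h0, norm_zero, Real.log_zero]
    positivity
  · rw [norm_scaledCoeff, Real.exp_neg, ← div_eq_mul_inv, div_le_iff₀ (Real.exp_pos _),
      ← Real.exp_add] at h
    have := (Real.log_le_iff_le_exp (norm_pos_iff.mpr h0)).mpr h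
    linarith

lemma sub_le_b_iff {z : ℍ} {n : ℕ} (hn : 1 ≤ n) {δ : ℝ} (hδ : δ < z.im) :
    z.im - δ ≤ b (j z) n ↔ Real.exp (-(2 * Real.pi * δ * n)) ≤ ‖scaledCoeff z n‖ := by
  have hpi := Real.pi_pos
  have hn0 : (0 : ℝ) < n := by exact_mod_cast hn
  have hd : 0 < 2 * Real.pi * n := by positivity
  rcases eq_or_ne (a (j z) n) 0 with h0 | h0
  · rw [b, scaledCoeff, h0]
    simp only [norm_zero, Real.log_zero, zero_div, zero_mul]
    -- The hypothesis δ < y serves here: the default value b(n) = 0 must not count as a large one.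
    exact iff_of_false (by linarith) (Real.exp_pos _).not_ge
  · rw [b, le_div_iff₀ hd, Real.le_log_iff_exp_le (norm_pos_iff.mpr h0), norm_scaledCoeff,
      Real.exp_neg (2 * Real.pi * n * z.im), ← div_eq_mul_inv, le_div_iff₀ (Real.exp_pos _),
      ← Real.exp_add]
    ring_nf

lemma eventually_b_le {z : ℍ} {K : ℝ} (hK : ∀ᶠ n in atTop, ‖scaledCoeff z n‖ ≤ K) {δ : ℝ}
    (hδ : 0 < δ) : ∀ᶠ n in atTop, b (j z) n ≤ z.im + δ := by
  have hpi := Real.pi_pos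
  have ht : Tendsto (fun n : ℕ => Real.exp (2 * Real.pi * n * δ)) atTop atTop :=
    Real.tendsto_exp_atTop.comp
      ((tendsto_natCast_atTop_atTop.const_mul_atTop (by positivity)).atTop_mul_const hδ)
  filter_upwards [hK, ht.eventually_ge_atTop K, eventually_ge_atTop 1] with n h1 h2 h3
  exact b_le_add h3 hδ (h1.trans h2)

lemma limsup_b_eq {z : ℍ} {K : ℝ} (hK : ∀ᶠ n in atTop, ‖scaledCoeff z n‖ ≤ K)
    (hf : ∀ δ : ℝ, 0 < δ → ∃ᶠ n : ℕ in atTop, Real.exp (-(δ * n)) ≤ ‖scaledCoeff z n‖) :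
    limsup (fun n => (b (j z) n : EReal)) atTop = (z.im : EReal) := by
  have hpi := Real.pi_pos
  have hy := z.im_pos
  apply le_antisymm
  · rw [limsup_le_iff]
    intro y hyy
    obtain ⟨y', h1, h2⟩ := EReal.lt_iff_exists_real_btwn.mp hyy
    have h1 : z.im < y' := by exact_mod_cast h1
    filter_upwards [eventually_b_le hK (sub_pos.mpr h1)] with n hn
    refine lt_of_le_of_lt ?_ h2
    exact_mod_cast hn.trans (by linarith)
  · rw [le_limsup_iff]
    intro y hyy
    obtain ⟨y', h1, h2⟩ := EReal.lt_iff_exists_real_btwn.mp hyy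
    have h2 : y' < z.im := by exact_mod_cast h2
    set δ := min (z.im - y') (z.im / 2) with hδ
    have hδ0 : 0 < δ := lt_min (sub_pos.mpr h2) (by linarith)
    have hδ1 : δ < z.im := (min_le_right _ _).trans_lt (by linarith)
    refine ((hf (2 * Real.pi * δ) (by positivity)).and_eventually
      (eventually_ge_atTop 1)).mono fun n hn => lt_of_lt_of_le h1 ?_
    have := (sub_le_b_iff hn.2 hδ1).mpr hn.1
    have h3 : δ ≤ z.im - y' := min_le_left _ _
    exact_mod_cast (by linarith : y' ≤ b (j z) n)

lemma tendsto_b_iff {z : ℍ} {K : ℝ} (hK : ∀ᶠ n in atTop, ‖scaledCoeff z n‖ ≤ K) :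
    Tendsto (b (j z)) atTop (𝓝 z.im) ↔ SubexpLower (scaledCoeff z) := by
  have hpi := Real.pi_pos
  have hy := z.im_pos
  constructor
  · intro h δ hδ
    set δ' := min (δ / (2 * Real.pi)) (z.im / 2) with hδ'
    have hδ0 : 0 < δ' := lt_min (by positivity) (by linarith)
    have hδ1 : δ' < z.im := (min_le_right _ _).trans_lt (by linarith)
    have hδ2 : 2 * Real.pi * δ' ≤ δ := by
      have : δ' ≤ δ / (2 * Real.pi) := min_le_left _ _
      rw [le_div_iff₀ (by positivity)] at this
      linarith
    filter_upwards [h.eventually_const_le (by linarith : z.im - δ' < z.im),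
      eventually_ge_atTop 1] with n h1 h2
    refine le_trans (Real.exp_le_exp.mpr ?_) ((sub_le_b_iff h2 hδ1).mp h1)
    have : (0 : ℝ) ≤ n := n.cast_nonneg
    nlinarith
  · intro h
    rw [Metric.tendsto_nhds]
    intro ε hε
    set δ := min (ε / 2) (z.im / 2) with hδ
    have hδ0 : 0 < δ := lt_min (by positivity) (by linarith)
    have hδ1 : δ < z.im := (min_le_right _ _).trans_lt (by linarith)
    have hδ2 : δ ≤ ε / 2 := min_le_left _ _
    filter_upwards [h (2 * Real.pi * δ) (by positivity), eventually_b_le hK (half_pos hε),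
      eventually_ge_atTop 1] with n h1 h2 h3
    have := (sub_le_b_iff h3 hδ1).mpr h1
    rw [Real.dist_eq, abs_lt]
    constructor <;> linarith

/-! ### The three cases -/

/-- If |2cos θ| < 1, then cos 2θ = 2cos²θ - 1 < -1/2, so one of the indices N and 2N always works.
-/
lemma frequently_one_le_abs_two_cos (x : ℝ) :
    ∃ᶠ n : ℕ in atTop, 1 ≤ ‖((2 * Real.cos (2 * Real.pi * n * x) : ℝ) : ℂ)‖ := by
  refine frequently_atTop.mpr fun N => ?_
  simp only [Complex.norm_real, Real.norm_eq_abs, abs_mul, abs_two]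
  by_cases h : 1 ≤ 2 * |Real.cos (2 * Real.pi * N * x)|
  · exact ⟨N, le_rfl, h⟩
  · refine ⟨2 * N, by omega, ?_⟩
    push Not at h
    have h1 : 2 * Real.pi * ((2 * N : ℕ) : ℝ) * x = 2 * (2 * Real.pi * N * x) := by
      push_cast; ring
    rw [h1, Real.cos_two_mul]
    have h2 : Real.cos (2 * Real.pi * N * x) ^ 2 < 1 / 4 := by
      rw [← sq_abs]
      nlinarith [abs_nonneg (Real.cos (2 * Real.pi * N * x))]
    rw [abs_of_neg (by linarith)]
    linarith

/-- The asymptotics of the coefficients at a point of the fundamental domain, by cases. -/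
lemma exists_main_term {z : ℍ} (hz : z ∈ fundamentalDomain) :
    ∃ g : ℕ → ℂ, (ExpSmall fun n => scaledCoeff z n - g n) ∧ (∀ n, ‖g n‖ ≤ 3) ∧
      (∃ᶠ n in atTop, 1 ≤ ‖g n‖) ∧ (SubexpLower g ↔ (1 < ‖(z : ℂ)‖ ∨ ∀ ε : ℝ, 0 < ε →
        ∀ᶠ n : ℕ in atTop, Real.exp (-(ε * n)) ≤ |Real.cos (2 * Real.pi * n * z.re)|)) := by
  rcases hz.1.lt_or_eq with h | h
  · have hn : ∀ n : ℕ, ‖Complex.exp (-(2 * Real.pi * Complex.I * n * z.re))‖ = 1 := fun n => by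
      rw [show -(2 * Real.pi * Complex.I * n * z.re : ℂ) =
        ((-(2 * Real.pi * n * z.re) : ℝ) : ℂ) * Complex.I by push_cast; ring,
        Complex.norm_exp_ofReal_mul_I]
    exact ⟨_, expSmall_of_one_lt_norm hz h, fun n => by rw [hn]; norm_num,
      (Eventually.of_forall fun n => (hn n).ge).frequently,
      iff_of_true (subexpLower_of_one_le fun n => (hn n).ge) (.inl h)⟩
  · rcases hz.2.1.lt_or_eq with hre | hre
    · refine ⟨_, expSmall_of_norm_eq_one hz h.symm hre, fun n => ?_,
        frequently_one_le_abs_two_cos z.re, ?_⟩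
      · rw [Complex.norm_real, Real.norm_eq_abs, abs_mul, abs_two]
        linarith [Real.abs_cos_le_one (2 * Real.pi * n * z.re)]
      · have hno : ¬ 1 < ‖(z : ℂ)‖ := h.symm.le.not_gt
        simp only [SubexpLower, Complex.norm_real, Real.norm_eq_abs, abs_mul, abs_two, hno,
          false_or]
        refine ⟨fun H ε hε => ?_, fun H ε hε => ?_⟩
        · filter_upwards [H (ε / 2) (half_pos hε),
            eventually_const_mul_exp_le 2 (half_lt_self hε)] with n h1 h2
          linarith
        · filter_upwards [H ε hε] with n h1
          linarith [abs_nonneg (Real.cos (2 * Real.pi * n * z.re))]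
    · have hn : ∀ n : ℕ, ‖(3 * (-1) ^ n : ℂ)‖ = 3 := fun n => by simp
      refine ⟨_, expSmall_of_re_eq hz h.symm hre.symm, fun n => (hn n).le,
        (Eventually.of_forall fun n => by rw [hn]; norm_num).frequently,
        iff_of_true (subexpLower_of_one_le fun n => by rw [hn]; norm_num) (.inr fun ε hε => ?_)⟩
      refine Eventually.of_forall fun n => ?_
      rw [← hre, show 2 * Real.pi * n * (-(1 / 2)) = -(n * Real.pi) by ring, Real.cos_neg,
        Real.cos_nat_mul_pi, abs_pow, abs_neg, abs_one, one_pow, Real.exp_le_one_iff, neg_nonpos]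
      positivity

lemma exists_eventually_norm_scaledCoeff_le {z : ℍ} (hz : z ∈ fundamentalDomain) :
    ∃ K : ℝ, ∀ᶠ n in atTop, ‖scaledCoeff z n‖ ≤ K := by
  obtain ⟨g, h1, h2, -⟩ := exists_main_term hz
  have := h1.tendsto.norm
  rw [norm_zero] at this
  refine ⟨4, (this.eventually_le_const one_pos).mono fun n hn => ?_⟩
  have h3 := norm_sub_norm_le (scaledCoeff z n) (g n)
  linarith [h2 n]

theorem limsup_b {z : ℍ} (hz : z ∈ fundamentalDomain) :
    limsup (fun n => (b (j z) n : EReal)) atTop = (z.im : EReal) := by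
  obtain ⟨K, hK⟩ := exists_eventually_norm_scaledCoeff_le hz
  obtain ⟨g, h1, -, h3, -⟩ := exists_main_term hz
  exact limsup_b_eq hK fun δ hδ => frequently_of_expSmall_sub h1 h3 hδ

theorem tendsto_b_iff_cos {z : ℍ} (hz : z ∈ fundamentalDomain) :
    Tendsto (b (j z)) atTop (𝓝 z.im) ↔ (1 < ‖(z : ℂ)‖ ∨ ∀ ε : ℝ, 0 < ε →
      ∀ᶠ n : ℕ in atTop, Real.exp (-(ε * n)) ≤ |Real.cos (2 * Real.pi * n * z.re)|) := by
  obtain ⟨K, hK⟩ := exists_eventually_norm_scaledCoeff_le hz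
  obtain ⟨g, h1, -, -, h4⟩ := exists_main_term hz
  rw [tendsto_b_iff hK, subexpLower_iff h1, h4]

/-- Both imaginary parts equal the same limsup, which depends only on the common value of j;
injectivity of j on the domain is not invoked. -/
lemma im_eq_of_j_eq {z w : ℍ} (hz : z ∈ fundamentalDomain) (hw : w ∈ fundamentalDomain)
    (h : j z = j w) : z.im = w.im := by
  have h1 := limsup_b hz
  rw [h, limsup_b hw] at h1
  exact_mod_cast h1.symm

/-- The corner ρ is a zero of j, so Im z = √3/2. Then |z| ≥ 1 forces x² ≥ 1/4, and the strip leaves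
only x = -1/2. -/
theorem re_eq_of_j_eq_zero {z : ℍ} (hz : z ∈ fundamentalDomain) (h : j z = 0) :
    z.re = -(1 / 2) := by
  have h3 : (0 : ℝ) < √3 / 2 := by positivity
  have hs : √3 ^ 2 = 3 := Real.sq_sqrt (by norm_num)
  set ρ : ℍ := ⟨⟨-(1 / 2), √3 / 2⟩, h3⟩ with hρ
  have hre : ρ.re = -(1 / 2) := rfl
  have him : ρ.im = √3 / 2 := rfl
  have hn : ‖(ρ : ℂ)‖ = 1 := by
    have := sq_re_add_sq_im ρ
    rw [hre, him] at this
    nlinarith [norm_nonneg (ρ : ℂ)]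
  have hρF : ρ ∈ fundamentalDomain := ⟨hn.ge, hre.ge, by rw [hre]; norm_num, fun _ => by
    rw [hre]; norm_num⟩
  have hy := im_eq_of_j_eq hz hρF (h.trans (j_eq_zero hre hn).symm)
  rw [him] at hy
  obtain ⟨h1, h2, h4, -⟩ := hz
  have := sq_re_add_sq_im z
  rw [hy] at this
  nlinarith

/-! ### Convergence of the expansion -/

/-- A holomorphic function satisfying a homogeneous linear differential equation of order one on a
ball vanishes everywhere there if it vanishes somewhere. -/
lemma eq_zero_of_deriv_eq_mul {f g : ℂ → ℂ} {q₀ : ℂ} (hf : AnalyticAt ℂ f q₀)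
    (hg : AnalyticAt ℂ g q₀) (h0 : f q₀ = 0) (h : deriv f =ᶠ[𝓝 q₀] f * g) :
    ∀ᶠ q in 𝓝 q₀, f q = 0 := by
  rw [← analyticOrderAt_eq_top]
  by_contra htop
  -- At a zero of finite order m the derivative has order m - 1, whereas f · g has order at least m.
  have h1 := hf.analyticOrderAt_deriv_add_one
  rw [h0] at h1
  simp only [sub_zero] at h1
  rw [analyticOrderAt_congr h, analyticOrderAt_mul hf hg] at h1
  have h2 : analyticOrderAt f q₀ + 1 ≤ analyticOrderAt f q₀ :=
    calc analyticOrderAt f q₀ + 1 ≤ analyticOrderAt f q₀ + analyticOrderAt g q₀ + 1 := by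
          gcongr; exact le_self_add
      _ = _ := h1
  exact (ENat.lt_add_one_iff htop).mpr le_rfl |>.not_ge h2

/-- The power series in `q` with the coefficients `a α n`. -/
def coeffSeries (α : ℂ) : FormalMultilinearSeries ℂ ℂ ℂ :=
  .ofScalars ℂ (a α)

lemma hasFPowerSeriesAt_Hq (α : ℂ) : HasFPowerSeriesAt (Hq α) (coeffSeries α) 0 := by
  have h := (analyticAt_Hq_zero α).hasFPowerSeriesAt
  have he : a α = fun n => iteratedDeriv n (Hq α) 0 / n.factorial := by
    funext n
    rw [a_eq, div_eq_inv_mul]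
  rwa [coeffSeries, he]

lemma exp_le_radius {z : ℍ} (hz : z ∈ fundamentalDomain) :
    ENNReal.ofReal (Real.exp (-(2 * Real.pi * z.im))) ≤ (coeffSeries (j z)).radius := by
  obtain ⟨K, hK⟩ := exists_eventually_norm_scaledCoeff_le hz
  refine FormalMultilinearSeries.le_radius_of_isBigO (r := (Real.exp (-(2 * Real.pi * z.im))).toNNReal)
    _ (Asymptotics.IsBigO.of_bound K ?_)
  filter_upwards [hK] with n hn
  have h1 : ‖coeffSeries (j z) n‖ = ‖a (j z) n‖ := by
    rw [coeffSeries, FormalMultilinearSeries.ofScalars_norm]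
  rw [norm_scaledCoeff] at hn
  rw [h1, Real.coe_toNNReal _ (Real.exp_pos _).le, ← Real.exp_nat_mul, norm_one, mul_one,
    Real.norm_of_nonneg (by positivity)]
  convert hn using 3
  ring

/-- Convergence of the series S comes from the size of the coefficients; the point is that `Hq` has
no pole in this disc. With f = `qj` - αq, the identity theorem gives f S = `qj` - q `qj`', that is,
q f' = f (1 - S). A zero of f would force f = 0 throughout the disc, against f(0) = 1. -/
lemma hasSum_Hq {z : ℍ} (hz : z ∈ fundamentalDomain) {q : ℂ}
    (hq : ‖q‖ < Real.exp (-(2 * Real.pi * z.im))) :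
    HasSum (fun n => a (j z) n * q ^ n) (Hq (j z) q) := by
  set α := j z with hα
  set r := Real.exp (-(2 * Real.pi * z.im)) with hr
  have hr0 : 0 < r := Real.exp_pos _
  have hr1 : r ≤ 1 := Real.exp_le_one_iff.mpr (by
    have := Real.pi_pos
    have := z.im_pos
    rw [neg_nonpos]; positivity)
  have hrad : ENNReal.ofReal r ≤ (coeffSeries α).radius := exp_le_radius hz
  have hrad0 : 0 < (coeffSeries α).radius := (ENNReal.ofReal_pos.mpr hr0).trans_le hrad
  set S := (coeffSeries α).sum with hS
  have hSp : HasFPowerSeriesOnBall S (coeffSeries α) 0 (coeffSeries α).radius :=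
    (coeffSeries α).hasFPowerSeriesOnBall hrad0
  have hmem : ∀ p : ℂ, ‖p‖ < r → p ∈ Metric.eball (0 : ℂ) (coeffSeries α).radius := by
    intro p hp
    rw [Metric.mem_eball, edist_zero_right]
    refine lt_of_lt_of_le ?_ hrad
    rwa [← ofReal_norm, ENNReal.ofReal_lt_ofReal_iff hr0]
  have hSan : ∀ p : ℂ, ‖p‖ < r → AnalyticAt ℂ S p := fun p hp =>
    hSp.analyticAt_of_mem (hmem p hp)
  have hev : S =ᶠ[𝓝 0] Hq α := by
    filter_upwards [hSp.hasFPowerSeriesAt.eventually_hasSum_sub,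
      (hasFPowerSeriesAt_Hq α).eventually_hasSum_sub] with p h1 h2
    exact h1.unique h2
  set f : ℂ → ℂ := fun q => qj q - α * q with hf
  have hfan : ∀ p : ℂ, ‖p‖ < r → AnalyticAt ℂ f p := fun p hp =>
    (analyticAt_qj (hp.trans_le hr1)).sub (analyticAt_const.mul analyticAt_id)
  have hfd : ∀ p : ℂ, ‖p‖ < r → deriv f p = deriv qj p - α := by
    intro p hp
    have h : HasDerivAt f (deriv qj p - α * 1) p :=
      (differentiableAt_qj (hp.trans_le hr1)).hasDerivAt.sub ((hasDerivAt_id p).const_mul α)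
    rw [h.deriv, mul_one]
  have hf0 : f 0 = 1 := by simp [hf, qj_zero]
  have hconn : IsPreconnected (Metric.ball (0 : ℂ) r) := (convex_ball _ _).isPreconnected
  have h0mem : (0 : ℂ) ∈ Metric.ball (0 : ℂ) r := Metric.mem_ball_self hr0
  have hprod : ∀ p : ℂ, ‖p‖ < r → f p * S p = qj p - p * deriv qj p := by
    have hG : AnalyticOnNhd ℂ (fun p => f p * S p - (qj p - p * deriv qj p))
        (Metric.ball 0 r) := by
      intro p hp
      have hp : ‖p‖ < r := by simpa using hp
      have h1 := analyticAt_qj (hp.trans_le hr1)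
      exact ((hfan p hp).mul (hSan p hp)).sub (h1.sub (analyticAt_id.mul h1.deriv))
    have hG0 : (fun p => f p * S p - (qj p - p * deriv qj p)) =ᶠ[𝓝 0] 0 := by
      filter_upwards [hev, (hfan 0 (by simpa)).continuousAt.eventually_ne
        (by rw [hf0]; exact one_ne_zero)] with p h1 h2
      rw [h1, Hq, Pi.zero_apply, mul_div_cancel₀ _ h2, sub_self]
    intro p hp
    have := hG.eqOn_zero_of_preconnected_of_eventuallyEq_zero hconn h0mem hG0
      (show p ∈ Metric.ball 0 r by simpa using hp)
    exact sub_eq_zero.mp this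
  have hfne : ∀ p : ℂ, ‖p‖ < r → f p ≠ 0 := by
    intro p hp hfp
    have hp0 : p ≠ 0 := by
      rintro rfl
      rw [hf0] at hfp
      exact one_ne_zero hfp
    have hode : deriv f =ᶠ[𝓝 p] f * fun q => (1 - S q) / q := by
      filter_upwards [Metric.isOpen_ball.mem_nhds (show p ∈ Metric.ball 0 r by simpa using hp),
        isOpen_ne.mem_nhds hp0] with w hw hw0
      have hw : ‖w‖ < r := by simpa using hw
      have hw0 : w ≠ 0 := hw0
      have h1 := hprod w hw
      rw [hfd w hw, Pi.mul_apply, ← mul_div_assoc, eq_div_iff hw0]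
      have h2 : f w = qj w - α * w := rfl
      linear_combination h1 - h2
    have hev0 := eq_zero_of_deriv_eq_mul (hfan p hp)
      ((analyticAt_const.sub (hSan p hp)).div analyticAt_id hp0) hfp hode
    have := AnalyticOnNhd.eqOn_zero_of_preconnected_of_eventuallyEq_zero (f := f)
      (fun w hw => hfan w (by simpa using hw)) hconn
      (show p ∈ Metric.ball 0 r by simpa using hp) hev0 h0mem
    rw [hf0] at this
    exact one_ne_zero this
  have hsum := (coeffSeries α).hasSum (hmem q hq)
  have hval : (coeffSeries α).sum q = Hq α q := by
    rw [Hq, eq_div_iff (hfne q hq), mul_comm]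
    exact hprod q hq
  rw [hval] at hsum
  simpa [coeffSeries, FormalMultilinearSeries.ofScalars_apply_eq, mul_comm] using hsum

theorem hasSum_H {z : ℍ} (hz : z ∈ fundamentalDomain) {τ : ℍ} (hτ : z.im < τ.im) :
    HasSum (fun n : ℕ => a (j z) n * Complex.exp (2 * (Real.pi : ℂ) * Complex.I * n * τ))
      (H (j z) τ) := by
  rw [H_eq_Hq]
  have hq : ‖qParam 1 τ‖ < Real.exp (-(2 * Real.pi * z.im)) := by
    rw [norm_qParam, div_one]
    apply Real.exp_lt_exp.mpr
    have := Real.pi_pos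
    have h : (τ : ℂ).im = τ.im := rfl
    rw [h]
    nlinarith
  refine (hasSum_Hq hz hq).congr_fun fun n => ?_
  rw [qParam_one, ← Complex.exp_nat_mul]
  ring_nf

/-! ### Recovering the real part -/

lemma arccos_cos_eq (θ : ℝ) : ∃ σ : ℝ, (σ = 1 ∨ σ = -1) ∧
    ∃ m : ℤ, Real.arccos (Real.cos θ) = σ * θ + 2 * m * Real.pi := by
  obtain ⟨k, hk | hk⟩ := Real.cos_eq_cos_iff.mp
    (Real.cos_arccos (Real.neg_one_le_cos θ) (Real.cos_le_one θ)).symm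
  · exact ⟨1, .inl rfl, k, by rw [hk]; ring⟩
  · exact ⟨-1, .inr rfl, k, by rw [hk]; ring⟩

/-- Modulo 2π the two arccosines are ±θ and ±(θ - 2πx), so x is a signed sum of V and V' up to an
integer. Since V and V' lie in [0, 1/2] and -1/2 ≤ x < 1/2, few integers remain. In a difference V -
V' a nonzero integer is possible only for x = -1/2, where flipping the sign absorbs it. -/
lemma exists_sign_of_arccos_cos {x : ℝ} (h1 : -(1 / 2) ≤ x) (h2 : x < 1 / 2) (θ : ℝ) :
    ∃ s t : ℝ, (s = 1 ∨ s = -1) ∧ (t = 1 ∨ t = -1) ∧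
      (x = s / (2 * Real.pi) * (Real.arccos (Real.cos θ) +
          t * Real.arccos (Real.cos (θ - 2 * Real.pi * x))) ∨
       x = s / (2 * Real.pi) * (Real.arccos (Real.cos θ) +
          Real.arccos (Real.cos (θ - 2 * Real.pi * x)) - 2 * Real.pi)) := by
  have hpi := Real.pi_pos
  obtain ⟨σ, hσ, m, hv⟩ := arccos_cos_eq θ
  obtain ⟨σ', hσ', m', hv'⟩ := arccos_cos_eq (θ - 2 * Real.pi * x)
  set v := Real.arccos (Real.cos θ) with hvdef
  set v' := Real.arccos (Real.cos (θ - 2 * Real.pi * x)) with hvdef'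
  have b1 : 0 ≤ v / (2 * Real.pi) := div_nonneg (Real.arccos_nonneg _) (by positivity)
  have b2 : v / (2 * Real.pi) ≤ 1 / 2 := by
    rw [div_le_iff₀ (by positivity)]; linarith [Real.arccos_le_pi (Real.cos θ)]
  have b1' : 0 ≤ v' / (2 * Real.pi) := div_nonneg (Real.arccos_nonneg _) (by positivity)
  have b2' : v' / (2 * Real.pi) ≤ 1 / 2 := by
    rw [div_le_iff₀ (by positivity)]
    linarith [Real.arccos_le_pi (Real.cos (θ - 2 * Real.pi * x))]
  set V := v / (2 * Real.pi) with hV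
  set V' := v' / (2 * Real.pi) with hV'
  have e1 : ∀ s t : ℝ, s / (2 * Real.pi) * (v + t * v') = s * (V + t * V') := by
    intro s t; rw [hV, hV']; ring
  have e2 : ∀ s : ℝ, s / (2 * Real.pi) * (v + v' - 2 * Real.pi) = s * (V + V' - 1) := by
    intro s; rw [hV, hV']; field_simp
  have hint : ∀ k : ℤ, -2 < (k : ℝ) → (k : ℝ) < 2 → k = -1 ∨ k = 0 ∨ k = 1 := by
    intro k h1 h2
    have h1 : -2 < k := by exact_mod_cast h1
    have h2 : k < 2 := by exact_mod_cast h2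
    omega
  simp only [e1, e2]
  have hθ : V = σ * (θ / (2 * Real.pi)) + m := by rw [hV, hv]; field_simp
  have hθ' : V' = σ' * (θ / (2 * Real.pi) - x) + m' := by rw [hV', hv']; field_simp
  rcases hσ with rfl | rfl <;> rcases hσ' with rfl | rfl
  · have hx : x = V - V' - ((m - m' : ℤ) : ℝ) := by rw [hθ, hθ']; push_cast; ring
    rcases hint (m - m') (by linarith) (by linarith) with h | h | h <;> rw [h] at hx <;>
      push_cast at hx
    · linarith
    · exact ⟨1, -1, .inl rfl, .inr rfl, .inl (by linarith)⟩
    · exact ⟨-1, -1, .inr rfl, .inr rfl, .inl (by linarith)⟩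
  · have hx : x = V + V' - ((m + m' : ℤ) : ℝ) := by rw [hθ, hθ']; push_cast; ring
    rcases hint (m + m') (by linarith) (by linarith) with h | h | h <;> rw [h] at hx <;>
      push_cast at hx
    · linarith
    · exact ⟨1, 1, .inl rfl, .inl rfl, .inl (by linarith)⟩
    · exact ⟨1, 1, .inl rfl, .inl rfl, .inr (by linarith)⟩
  · have hx : x = -(V + V') + ((m + m' : ℤ) : ℝ) := by rw [hθ, hθ']; push_cast; ring
    rcases hint (m + m') (by linarith) (by linarith) with h | h | h <;> rw [h] at hx <;>
      push_cast at hx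
    · linarith
    · exact ⟨-1, 1, .inr rfl, .inl rfl, .inl (by linarith)⟩
    · exact ⟨-1, 1, .inr rfl, .inl rfl, .inr (by linarith)⟩
  · have hx : x = V' - V + ((m - m' : ℤ) : ℝ) := by rw [hθ, hθ']; push_cast; ring
    rcases hint (m - m') (by linarith) (by linarith) with h | h | h <;> rw [h] at hx <;>
      push_cast at hx
    · exact ⟨1, -1, .inl rfl, .inr rfl, .inl (by linarith)⟩
    · exact ⟨-1, -1, .inr rfl, .inr rfl, .inl (by linarith)⟩
    · linarith

/-- Perturbed cosines may leave [-1, 1]; the constant extension of arccos is still uniformly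
continuous on [-2, 2]. -/
lemma exists_dist_arccos_lt {ε : ℝ} (hε : 0 < ε) : ∃ δ : ℝ, 0 < δ ∧
    ∀ u v : ℝ, |v| ≤ 1 → |u - v| < δ → |Real.arccos u - Real.arccos v| < ε := by
  have hK : IsCompact (Set.Icc (-2 : ℝ) 2) := isCompact_Icc
  obtain ⟨δ, hδ, h⟩ := Metric.uniformContinuousOn_iff.mp
    (hK.uniformContinuousOn_of_continuous Real.continuous_arccos.continuousOn) ε hε
  refine ⟨min δ 1, lt_min hδ one_pos, fun u v hv huv => ?_⟩
  have h1 := abs_le.mp hv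
  have h2 := abs_lt.mp (huv.trans_le (min_le_right _ _))
  exact h u ⟨by linarith, by linarith⟩ v ⟨by linarith, by linarith⟩
    (huv.trans_le (min_le_left _ _))

/-- If a real sequence is asymptotic to `cos(2πnx)`, then the arccosines of two consecutive terms
determine `x` up to finitely many choices, also after a small perturbation. -/
theorem recover_re {x y : ℝ} (h1 : -(1 / 2) ≤ x) (h2 : x < 1 / 2) {C : ℝ → ℕ → ℝ}
    (hC : ∀ y₀ n, C y₀ n = C y n * Real.exp (-(2 * Real.pi * n * (y₀ - y))))
    (hlim : Tendsto (fun n : ℕ => C y n - Real.cos (2 * Real.pi * n * x)) atTop (𝓝 0))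
    {ε : ℝ} (hε : 0 < ε) :
    ∃ ρ : ℝ, 0 < ρ ∧ ∃ N : ℕ, 1 ≤ N ∧ ∀ n : ℕ, N ≤ n → ∀ y₀ : ℝ, |y₀ - y| ≤ ρ / n →
      ∃ s t : ℝ, (s = 1 ∨ s = -1) ∧ (t = 1 ∨ t = -1) ∧
        (|x - s / (2 * Real.pi) *
            (Real.arccos (C y₀ n) + t * Real.arccos (C y₀ (n - 1)))| < ε ∨
         |x - s / (2 * Real.pi) *
            (Real.arccos (C y₀ n) + Real.arccos (C y₀ (n - 1)) - 2 * Real.pi)| < ε) := by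
  have hpi := Real.pi_gt_three
  obtain ⟨δ, hδ, harc⟩ := exists_dist_arccos_lt hε
  -- Two errors add up: |C| ≤ 2 times an exponential within 2ζ of 1, and the distance ζ to the
  -- cosine. The total 5ζ stays below δ.
  set ζ := min (δ / 8) (1 / 2) with hζ
  have hζ0 : 0 < ζ := lt_min (by positivity) (by norm_num)
  have hζ1 : ζ ≤ 1 / 2 := min_le_right _ _
  have hζ2 : ζ ≤ δ / 8 := min_le_left _ _
  obtain ⟨M, hM⟩ := (Metric.tendsto_atTop.mp hlim) ζ hζ0
  set ρ := ζ / (2 * Real.pi) with hρ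
  have hρ0 : 0 < ρ := by positivity
  have key : ∀ k : ℕ, M ≤ k → ∀ y₀ : ℝ, k * |y₀ - y| ≤ ρ →
      |Real.arccos (C y₀ k) - Real.arccos (Real.cos (2 * Real.pi * k * x))| < ε := by
    intro k hk y₀ hy₀
    refine harc _ _ (Real.abs_cos_le_one _) ?_
    have hd := hM k hk
    rw [Real.dist_eq, sub_zero] at hd
    set u := -(2 * Real.pi * k * (y₀ - y)) with hu
    have hu1 : |u| ≤ ζ := by
      rw [hu, abs_neg, abs_mul, abs_of_nonneg (by positivity)]
      rw [hρ, le_div_iff₀ (by positivity)] at hy₀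
      linarith
    have he := Real.abs_exp_sub_one_le (x := u) (by linarith)
    have hCk : |C y k| ≤ 2 := by
      have h3 := abs_sub_abs_le_abs_sub (C y k) (Real.cos (2 * Real.pi * k * x))
      have h4 := Real.abs_cos_le_one (2 * Real.pi * k * x)
      linarith
    rw [hC y₀ k, show C y k * Real.exp u - Real.cos (2 * Real.pi * k * x)
      = C y k * (Real.exp u - 1) + (C y k - Real.cos (2 * Real.pi * k * x)) by ring]
    calc _ ≤ |C y k| * |Real.exp u - 1| + |C y k - Real.cos (2 * Real.pi * k * x)| := by
          rw [← abs_mul]; exact abs_add_le _ _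
      _ < 2 * (2 * ζ) + ζ := by
          refine add_lt_add_of_le_of_lt (mul_le_mul hCk (by linarith) (abs_nonneg _)
            (by norm_num)) hd
      _ ≤ δ := by linarith
  -- The shift by one makes the estimate valid at n - 1 as well and keeps the natural subtraction
  -- exact.
  refine ⟨ρ, hρ0, M + 1, by omega, fun n hn y₀ hy₀ => ?_⟩
  have hn0 : (0 : ℝ) < n := by exact_mod_cast (by omega : 0 < n)
  rw [le_div_iff₀ hn0] at hy₀
  have hcast : ((n - 1 : ℕ) : ℝ) = n - 1 := by
    rw [Nat.cast_sub (by omega), Nat.cast_one]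
  have k1 := abs_lt.mp (key n (by omega) y₀ (by linarith))
  have k2 := abs_lt.mp (key (n - 1) (by omega) y₀ (by
    rw [hcast]
    nlinarith [abs_nonneg (y₀ - y)]))
  rw [show 2 * Real.pi * ((n - 1 : ℕ) : ℝ) * x = 2 * Real.pi * n * x - 2 * Real.pi * x by
    rw [hcast]; ring] at k2
  obtain ⟨s, t, hs, ht, h⟩ := exists_sign_of_arccos_cos h1 h2 (2 * Real.pi * n * x)
  refine ⟨s, t, hs, ht, ?_⟩
  set v := Real.arccos (Real.cos (2 * Real.pi * n * x))
  set v' := Real.arccos (Real.cos (2 * Real.pi * n * x - 2 * Real.pi * x))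
  have hsabs : |s| = 1 := by rcases hs with rfl | rfl <;> simp
  have hfin : ∀ d : ℝ, |d| < 2 * ε → |s / (2 * Real.pi) * d| < ε := by
    intro d hd
    rw [abs_mul, abs_div, hsabs, abs_of_pos Real.two_pi_pos, one_div, inv_mul_lt_iff₀ (by positivity)]
    nlinarith
  refine h.imp (fun h => ?_) (fun h => ?_)
  · have : x - s / (2 * Real.pi) * (Real.arccos (C y₀ n) + t * Real.arccos (C y₀ (n - 1)))
        = s / (2 * Real.pi) * ((v - Real.arccos (C y₀ n)) +
          t * (v' - Real.arccos (C y₀ (n - 1)))) := by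
      linear_combination h
    rw [this]
    refine hfin _ (abs_lt.mpr ?_)
    rcases ht with rfl | rfl <;> constructor <;> linarith
  · have : x - s / (2 * Real.pi) * (Real.arccos (C y₀ n) + Real.arccos (C y₀ (n - 1))
        - 2 * Real.pi) = s / (2 * Real.pi) * ((v - Real.arccos (C y₀ n)) +
          (v' - Real.arccos (C y₀ (n - 1)))) := by
      linear_combination h
    rw [this]
    refine hfin _ (abs_lt.mpr ?_)
    constructor <;> linarith

/-! ### The condition `UnitLimit` -/

lemma unitLimit_iff (z : ℍ) :
    UnitLimit (j z) z.im ↔ Tendsto (fun n => ‖scaledCoeff z n‖) atTop (𝓝 1) := by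
  simp only [UnitLimit, norm_scaledCoeff]

lemma unitLimit_of_one_lt_norm {z : ℍ} (hz : z ∈ fundamentalDomain) (h : 1 < ‖(z : ℂ)‖) :
    UnitLimit (j z) z.im := by
  rw [unitLimit_iff]
  have hlim := (expSmall_of_one_lt_norm hz h).tendsto
  rw [Metric.tendsto_atTop] at hlim ⊢
  intro ε hε
  obtain ⟨N, hN⟩ := hlim ε hε
  refine ⟨N, fun n hn => ?_⟩
  have h1 := hN n hn
  have hn : ‖Complex.exp (-(2 * Real.pi * Complex.I * n * z.re))‖ = 1 := by
    rw [show -(2 * Real.pi * Complex.I * n * z.re : ℂ) =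
      ((-(2 * Real.pi * n * z.re) : ℝ) : ℂ) * Complex.I by push_cast; ring,
      Complex.norm_exp_ofReal_mul_I]
  rw [dist_zero_right] at h1
  rw [Real.dist_eq, ← hn]
  exact (abs_norm_sub_norm_le _ _).trans_lt h1

/-- With d = |2cos θ|, tripling the angle gives d|d² - 3|, which is near 2 when d is near 1; so N
and 3N cannot both give values near 1. Doubling would not do, as d ↦ |d² - 2| fixes 1. -/
lemma not_tendsto_abs_two_cos (x : ℝ) :
    ¬ Tendsto (fun n : ℕ => |2 * Real.cos (2 * Real.pi * n * x)|) atTop (𝓝 1) := by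
  intro h
  obtain ⟨N, hN⟩ := (Metric.tendsto_atTop.mp h) (1 / 8) (by norm_num)
  have h1 := hN N le_rfl
  have h3 := hN (3 * N) (by omega)
  rw [Real.dist_eq, abs_lt] at h1 h3
  rw [show 2 * Real.pi * ((3 * N : ℕ) : ℝ) * x = 3 * (2 * Real.pi * N * x) by push_cast; ring,
    Real.cos_three_mul] at h3
  set c := Real.cos (2 * Real.pi * N * x)
  have e : |2 * (4 * c ^ 3 - 3 * c)| = |2 * c| * |(2 * c) ^ 2 - 3| := by
    rw [← abs_mul]; ring_nf
  have hsq : (2 * c) ^ 2 = |2 * c| ^ 2 := (sq_abs _).symm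
  rw [e, hsq] at h3
  set d := |2 * c|
  have hd : |d ^ 2 - 3| = 3 - d ^ 2 := by
    rw [abs_of_neg (by nlinarith)]; ring
  rw [hd] at h3
  nlinarith

lemma not_unitLimit {z : ℍ} (hz : z ∈ fundamentalDomain) (h : ‖(z : ℂ)‖ = 1)
    (hre : -(1 / 2) < z.re) : ¬ UnitLimit (j z) z.im := by
  rw [unitLimit_iff]
  intro hlim
  have h0 := (expSmall_of_norm_eq_one hz h hre).tendsto.norm
  rw [norm_zero] at h0
  refine not_tendsto_abs_two_cos z.re ?_
  have h2 : Tendsto (fun n : ℕ => ‖scaledCoeff z n‖ - |2 * Real.cos (2 * Real.pi * n * z.re)|)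
      atTop (𝓝 0) := by
    refine squeeze_zero_norm (fun n => ?_) h0
    have := abs_norm_sub_norm_le (scaledCoeff z n)
      ((2 * Real.cos (2 * Real.pi * n * z.re) : ℝ) : ℂ)
    rwa [Complex.norm_real, Real.norm_eq_abs] at this
  simpa using hlim.sub h2

lemma c_eq (α : ℂ) (y y₀ : ℝ) (n : ℕ) :
    c α y y₀ n = c α y y n * Real.exp (-(2 * Real.pi * n * (y₀ - y))) := by
  have : Real.exp (-(2 * Real.pi * n * y₀)) =
      Real.exp (-(2 * Real.pi * n * y)) * Real.exp (-(2 * Real.pi * n * (y₀ - y))) := by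
    rw [← Real.exp_add]; ring_nf
  unfold c
  split_ifs <;> rw [this] <;> ring

lemma re_scaledCoeff (z : ℍ) (n : ℕ) :
    (scaledCoeff z n).re = (a (j z) n).re * Real.exp (-(2 * Real.pi * n * z.im)) := by
  rw [scaledCoeff, Complex.re_mul_ofReal]

/-- For α ≠ 0 the corner is excluded, so the case distinction in `c` separates |z| > 1 from the open
arc; the factor 1/2 compensates for the main term 2cos(2πnx) there. -/
lemma tendsto_c_sub_cos {z : ℍ} (hz : z ∈ fundamentalDomain) (h0 : j z ≠ 0) :
    Tendsto (fun n : ℕ => c (j z) z.im z.im n - Real.cos (2 * Real.pi * n * z.re)) atTop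
      (𝓝 0) := by
  rcases hz.1.lt_or_eq with h | h
  · have h1 := (Complex.continuous_re.tendsto 0).comp (expSmall_of_one_lt_norm hz h).tendsto
    refine h1.congr fun n => ?_
    rw [c, if_pos (unitLimit_of_one_lt_norm hz h), ← re_scaledCoeff, Function.comp_apply,
      Complex.sub_re, show -(2 * Real.pi * Complex.I * n * z.re : ℂ) =
      ((-(2 * Real.pi * n * z.re) : ℝ) : ℂ) * Complex.I by push_cast; ring,
      Complex.exp_ofReal_mul_I_re, Real.cos_neg]
  · have hre : -(1 / 2) < z.re := hz.2.1.lt_of_ne fun h' => h0 (j_eq_zero h'.symm h.symm)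
    have h1 := ((Complex.continuous_re.tendsto 0).comp
      (expSmall_of_norm_eq_one hz h.symm hre).tendsto).const_mul (1 / 2 : ℝ)
    rw [Complex.zero_re, mul_zero] at h1
    refine h1.congr fun n => ?_
    rw [c, if_neg (not_unitLimit hz h.symm hre), mul_assoc, ← re_scaledCoeff,
      Function.comp_apply, Complex.sub_re, Complex.ofReal_re]
    ring

lemma im_a_eq_zero {z : ℍ} (h : ‖(z : ℂ)‖ = 1) (n : ℕ) : (a (j z) n).im = 0 :=
  Complex.conj_eq_iff_im.mp (conj_a (j_eq_conj_of_norm_eq_one h) n)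

end JInversion

end

theorem theorem1p1 (α : ℂ) (z : ℍ) (hz : z ∈ JInversion.fundamentalDomain)
    (hα : JInversion.j z = α) :
    -- the expansion of `H` that defines the coefficients `a(n)`
    (∀ τ : ℍ, z.im < τ.im →
      HasSum (fun n : ℕ => JInversion.a α n * Complex.exp (2 * (Real.pi : ℂ) * Complex.I * n * τ))
        (JInversion.H α τ)) ∧
    -- the imaginary part
    Filter.limsup (fun n : ℕ => (JInversion.b α n : EReal)) Filter.atTop = (z.im : EReal) ∧
    (Filter.Tendsto (JInversion.b α) Filter.atTop (nhds z.im) ↔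
      (1 < ‖(z : ℂ)‖ ∨ ∀ ε : ℝ, 0 < ε →
        ∀ᶠ n : ℕ in Filter.atTop, Real.exp (-(ε * n)) ≤ |Real.cos (2 * Real.pi * n * z.re)|)) ∧
    -- the real part
    (α = 0 → z.re = -(1 / 2)) ∧
    (α ≠ 0 →
      (¬ JInversion.UnitLimit α z.im → ∀ n : ℕ, (JInversion.a α n).im = 0) ∧
      ∀ ε : ℝ, 0 < ε → ∃ η : ℝ, 0 < η ∧ ∃ N : ℕ, 1 ≤ N ∧ ∀ n : ℕ, N ≤ n →
        ∀ y₀ : ℝ, |y₀ - z.im| ≤ η / n →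
          ∃ s t : ℝ, (s = 1 ∨ s = -1) ∧ (t = 1 ∨ t = -1) ∧
            (|z.re - s / (2 * Real.pi) *
                (JInversion.w α z.im y₀ n + t * JInversion.w α z.im y₀ (n - 1))| < ε ∨
             |z.re - s / (2 * Real.pi) *
                (JInversion.w α z.im y₀ n + JInversion.w α z.im y₀ (n - 1) - 2 * Real.pi)| < ε)) := by
  subst hα
  refine ⟨fun τ hτ => JInversion.hasSum_H hz hτ, JInversion.limsup_b hz,
    JInversion.tendsto_b_iff_cos hz, JInversion.re_eq_of_j_eq_zero hz,
    fun h0 => ⟨fun hU n => ?_, fun ε hε => ?_⟩⟩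
  · refine JInversion.im_a_eq_zero (le_antisymm ?_ hz.1) n
    by_contra! h
    exact hU (JInversion.unitLimit_of_one_lt_norm hz h)
  · exact JInversion.recover_re hz.2.1 hz.2.2.1 (C := JInversion.c (JInversion.j z) z.im)
      (fun y₀ n => JInversion.c_eq _ _ y₀ n) (JInversion.tendsto_c_sub_cos hz h0) hε
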